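/- Let $n,m\ge 0$, let $E,F\in\mathbb C^{n\times m}$, and let $S$ be a linear relation in $\mathbb C^m$ (a linear subspace of $\mathbb C^m\times\mathbb C^m$) that coincides with the kernel representation $E^{-1}F=\{(x,y)\in\mathbb C^m\times\mathbb C^m : Fx=Ey\}$ of the matrix pencil $P(s)=sE-F$. Weyr characteristic $(W,A,B,C)$ of $S$. Products are $ST=\{(x,z): (x,y)\in T,\ (y,z)\in S \text{ for some } y\}$, and $S^0=I$ (the identity relation), $S^{k}=S\,S^{k-1}$, $S-\lambda=\{(x,y-\lambda x):(x,y)\in S\}$. Write $\operatorname{dom}S$, $R(S)$ for the domain and the range, $N(S)=\{x:(x,0)\in S\}$, $\operatorname{mul}S=\{y:(0,y)\in S\}$, $\mathcal R_0=\bigcup_k N(S^k)$, $\mathcal R_\infty=\bigcup_k \operatorname{mul}(S^k)$ and $\mathcal R_c=\mathcal R_0\cap\mathcal R_\infty$. For $k\ge1$ and $\lambda\in\mathbb C$ put $$W_k(\lambda)=\dim\frac{N((S-\lambda)^k)+\mathcal R_c}{N((S-\lambda)^{k-1})+\mathcal R_c},\quad A_k=\dim\frac{\operatorname{mul}(S^k)+\mathcal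 R_c}{\operatorname{mul}(S^{k-1})+\mathcal R_c},\quad B_k=\dim\frac{N(S^k)\cap\mathcal R_c}{N(S^{k-1})\cap\mathcal R_c},$$ $$C_1=\dim\frac{R(S)+\operatorname{dom}S}{R(S)+\mathcal R_0},\qquad C_k=\dim\frac{R(S^{k})+\mathcal R_0}{R(S^{k+1})+\mathcal R_0}\quad(k\ge2).$$ These sequences have only finitely many nonzero entries, and $W(\lambda)=(W_k(\lambda))_{k\ge1}$ is nonzero for only finitely many $\lambda$. Finite sequences are identified with their extensions by zeros, $W$ stands for the family $(W(\lambda))_{\lambda\in\mathbb C}$, and $|\cdot|$ denotes the sum of all entries. Weyr characteristic $(w,a,b,c)$ of $P$. By Kronecker's theorem there are invertible matrices $U\in\mathbb C^{m\times m}$, $V\in\mathbb C^{n\times n}$ such that $$V(sE-F)U=\operatorname{diag}\big(sI-J_0,\ sN_\alpha-I,\ sK_\beta-L_\beta,\ sK_\gamma^\top-L_\gamma^\top\big),$$ where $J_0$ is in Jordan normal form, $\alpha,\beta,\gamma$ are finite (possibly empty) sequences of positive integers, and $N_\alpha$, $K_\beta$, $L_\beta$ are block diagonal with blocks $N_{\alpha_i}$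 (the $\alpha_i\times\alpha_i$ matrix with ones on the first subdiagonal and zeros elsewhere), $K_{\beta_i}=[I\ 0]$ and $L_{\beta_i}=[0\ I]$ of size $(\beta_i-1)\times\beta_i$, and similarly for $\gamma$ (an entry $1$ of $\beta$ contributes a zero column, an entry $1$ of $\gamma$ a zero row). Then $w_k(\lambda)$ is the number of Jordan blocks of $J_0$ with eigenvalue $\lambda$ and size at least $k$, and $a$, $b$, $c$ are the conjugate partitions of $\alpha$, $\beta$, $\gamma$ (so $a_k$ is the number of indices $i$ with $\alpha_i\ge k$, and likewise for $b$, $c$). Then $P$ has a Weyr characteristic, it does not depend on the choice of the canonical form, and $$w=W,\qquad a=A,\qquad b=B,$$ $$c=(\,n-m+B_1,\ m-|W|-|A|-|B|-|C|,\ C_1,\ C_2,\ \ldots,\ C_{n_C}\,),$$ where $C=(C_1,\ldots,C_{n_C})$. -/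

import Mathlib

/-!
# Linear relations, matrix pencils and their Weyr characteristics

All characteristic sequences `(t_k)_{k ≥ 1}` are encoded as functions `ℕ → ℕ` with a shift of the
index by one: the value at `k` is the entry `t_{k+1}`. Finite sequences are padded by zeros.
-/

/-- A linear relation in a complex vector space `V` is a linear subspace of `V × V`. -/
abbrev LinRel (V : Type*) [AddCommGroup V] [Module ℂ V] := Submodule ℂ (V × V)

namespace LinRel

variable {V : Type*} [AddCommGroup V] [Module ℂ V]

/-- The domain `{x | ∃ y, (x, y) ∈ S}`. -/
def dom (S : LinRel V) : Submodule ℂ V := Submodule.map (LinearMap.fst ℂ V V) S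

/-- The range `R(S) = {y | ∃ x, (x, y) ∈ S}`. -/
def ran (S : LinRel V) : Submodule ℂ V := Submodule.map (LinearMap.snd ℂ V V) S

/-- The kernel `N(S) = {x | (x, 0) ∈ S}`. -/
def ker (S : LinRel V) : Submodule ℂ V := Submodule.comap (LinearMap.inl ℂ V V) S

/-- The multivalued part `mul(S) = {y | (0, y) ∈ S}`. -/
def mul (S : LinRel V) : Submodule ℂ V := Submodule.comap (LinearMap.inr ℂ V V) S

/-- The identity relation `{(x, x)}`. -/
def one (V : Type*) [AddCommGroup V] [Module ℂ V] : LinRel V :=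
  LinearMap.eqLocus (LinearMap.fst ℂ V V) (LinearMap.snd ℂ V V)

/-- The product `S T = {(x, z) | (y, z) ∈ S and (x, y) ∈ T for some y}`. -/
def comp (S T : LinRel V) : LinRel V where
  carrier := {p | ∃ y : V, (y, p.2) ∈ S ∧ (p.1, y) ∈ T}
  zero_mem' := ⟨0, S.zero_mem, T.zero_mem⟩
  add_mem' := by
    rintro p q ⟨y, hS, hT⟩ ⟨y', hS', hT'⟩
    exact ⟨y + y', S.add_mem hS hS', T.add_mem hT hT'⟩
  smul_mem' := by
    rintro c p ⟨y, hS, hT⟩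
    exact ⟨c • y, S.smul_mem c hS, T.smul_mem c hT⟩

/-- The powers `S ^ 0 = I`, `S ^ (k + 1) = S (S ^ k)`. -/
def pow (S : LinRel V) : ℕ → LinRel V
  | 0 => one V
  | k + 1 => comp S (pow S k)

/-- The relation `S - μ = {(x, y - μ x) | (x, y) ∈ S}`. -/
def sub (S : LinRel V) (μ : ℂ) : LinRel V :=
  Submodule.map
    ((LinearMap.fst ℂ V V).prod (LinearMap.snd ℂ V V - μ • LinearMap.fst ℂ V V)) S

/-- The root manifold `ℛ₀(S)`: the union of the increasing sequence `N(S ^ k)`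
(see `mem_rootZero`). -/
def rootZero (S : LinRel V) : Submodule ℂ V := ⨆ k : ℕ, ker (pow S k)

/-- The root manifold `ℛ_∞(S)`: the union of the increasing sequence `mul(S ^ k)`
(see `mem_rootInfty`). -/
def rootInfty (S : LinRel V) : Submodule ℂ V := ⨆ k : ℕ, mul (pow S k)

theorem ker_pow_mono (S : LinRel V) : Monotone fun k => ker (pow S k) := by
  refine monotone_nat_of_le_succ fun k x hx => ?_
  exact ⟨0, S.zero_mem, hx⟩

theorem mul_pow_mono (S : LinRel V) : Monotone fun k => mul (pow S k) := by
  refine monotone_nat_of_le_succ fun k => ?_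
  induction k with
  | zero =>
    intro y hy
    have h : (0 : V) = y := hy
    subst h
    exact Submodule.zero_mem _
  | succ k ih =>
    rintro y ⟨z, hz, h0⟩
    exact ⟨z, hz, ih h0⟩

theorem mem_rootZero (S : LinRel V) (x : V) : x ∈ rootZero S ↔ ∃ k, x ∈ ker (pow S k) :=
  Submodule.mem_iSup_of_directed _ (ker_pow_mono S).directed_le

theorem mem_rootInfty (S : LinRel V) (x : V) : x ∈ rootInfty S ↔ ∃ k, x ∈ mul (pow S k) :=
  Submodule.mem_iSup_of_directed _ (mul_pow_mono S).directed_le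

/-- The singular chains subspace `ℛ_c(S) = ℛ₀(S) ∩ ℛ_∞(S)`. -/
def singChains (S : LinRel V) : Submodule ℂ V := rootZero S ⊓ rootInfty S

/-- `dim (X / Y)`, for subspaces `Y ≤ X`. -/
noncomputable def quotDim (X Y : Submodule ℂ V) : ℕ :=
  Module.finrank ℂ (↥X ⧸ Y.submoduleOf X)

end LinRel

/-- The type of the collections `(w, a, b, c)`: a family of sequences indexed by the complex
numbers (the sequence at a number that is not an eigenvalue is zero), and three sequences. -/
@[ext]
structure WeyrChar where
  /-- the sequences of the finite eigenvalues -/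
  w : ℂ → ℕ → ℕ
  /-- the sequence of the eigenvalue `∞` -/
  a : ℕ → ℕ
  /-- the third sequence -/
  b : ℕ → ℕ
  /-- the fourth sequence -/
  c : ℕ → ℕ

/-- The absolute value `|t|` of a sequence: the sum of its (finitely many nonzero) entries. -/
noncomputable def seqAbs (t : ℕ → ℕ) : ℕ := ∑ᶠ k, t k

/-- The absolute value `|W|`: the sum of all entries belonging to all finite eigenvalues. -/
noncomputable def famAbs (W : ℂ → ℕ → ℕ) : ℕ := ∑ᶠ μ, seqAbs (W μ)

namespace LinRel

variable {V : Type*} [AddCommGroup V] [Module ℂ V]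

/-- `W_{k+1}(μ)`; it vanishes for all `k` unless `μ` is a proper eigenvalue, that is, unless
`N((S - μ) ^ k)` is not contained in `ℛ_c(S)` for some `k`. -/
noncomputable def weyrW (S : LinRel V) (μ : ℂ) (k : ℕ) : ℕ :=
  quotDim (ker (pow (sub S μ) (k + 1)) ⊔ singChains S) (ker (pow (sub S μ) k) ⊔ singChains S)

/-- `A_{k+1}`. -/
noncomputable def weyrA (S : LinRel V) (k : ℕ) : ℕ :=
  quotDim (mul (pow S (k + 1)) ⊔ singChains S) (mul (pow S k) ⊔ singChains S)

/-- `B_{k+1}`. -/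
noncomputable def weyrB (S : LinRel V) (k : ℕ) : ℕ :=
  quotDim (ker (pow S (k + 1)) ⊓ singChains S) (ker (pow S k) ⊓ singChains S)

/-- `C_{k+1}`, where `C_1 = dim (R(S) + dom S) / (R(S) + ℛ₀(S))` and
`C_j = dim (R(S ^ j) + ℛ₀(S)) / (R(S ^ (j + 1)) + ℛ₀(S))` for `j ≥ 2`. -/
noncomputable def weyrC (S : LinRel V) : ℕ → ℕ
  | 0 => quotDim (ran S ⊔ dom S) (ran S ⊔ rootZero S)
  | k + 1 => quotDim (ran (pow S (k + 2)) ⊔ rootZero S) (ran (pow S (k + 3)) ⊔ rootZero S)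

/-- The Weyr characteristic `(W, A, B, C)` of a linear relation (in a finite-dimensional space). -/
noncomputable def weyr (S : LinRel V) : WeyrChar where
  w := weyrW S
  a := weyrA S
  b := weyrB S
  c := weyrC S

end LinRel

/-- The kernel representation `E⁻¹ F = {(x, y) | F x = E y}` of the pencil `s E - F`. -/
def kernelRep {n m : ℕ} (E F : Matrix (Fin n) (Fin m) ℂ) : LinRel (Fin m → ℂ) :=
  LinearMap.eqLocus (F.mulVecLin ∘ₗ LinearMap.fst ℂ (Fin m → ℂ) (Fin m → ℂ))
    (E.mulVecLin ∘ₗ LinearMap.snd ℂ (Fin m → ℂ) (Fin m → ℂ))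

namespace Kronecker

/-- The Jordan block of size `k` with eigenvalue `μ` (ones above the diagonal). -/
def J (μ : ℂ) (k : ℕ) : Matrix (Fin k) (Fin k) ℂ :=
  Matrix.of fun i j => if i = j then μ else if (i : ℕ) + 1 = j then 1 else 0

/-- The nilpotent `k × k` matrix with ones below the diagonal. -/
def N (k : ℕ) : Matrix (Fin k) (Fin k) ℂ :=
  Matrix.of fun i j => if (j : ℕ) + 1 = i then 1 else 0

/-- The `(k - 1) × k` matrix `[I 0]`; for `k = 1` it is the empty matrix with no row and one
column, so that it contributes a zero column to a block diagonal matrix. -/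
def K (k : ℕ) : Matrix (Fin (k - 1)) (Fin k) ℂ :=
  Matrix.of fun i j => if (j : ℕ) = i then 1 else 0

/-- The `(k - 1) × k` matrix `[0 I]`. -/
def L (k : ℕ) : Matrix (Fin (k - 1)) (Fin k) ℂ :=
  Matrix.of fun i j => if (j : ℕ) = i + 1 then 1 else 0

/-- The entry with index `k + 1` of the conjugate partition of a multi-index `t`: the number of
entries of `t` that are at least `k + 1`. It does not depend on the order of the entries. -/
def conj {l : ℕ} (t : Fin l → ℕ) (k : ℕ) : ℕ :=
  (Finset.univ.filter fun i => k + 1 ≤ t i).card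

/-- The data of a Kronecker canonical form: the Jordan blocks (eigenvalues and sizes) of `J₀` and
the multi-indices `α`, `β`, `γ`, all of whose entries are positive. -/
structure Data where
  /-- the number of Jordan blocks -/
  nJ : ℕ
  /-- the number of entries of `α` -/
  nα : ℕ
  /-- the number of entries of `β` -/
  nβ : ℕ
  /-- the number of entries of `γ` -/
  nγ : ℕ
  /-- the eigenvalues of the Jordan blocks -/
  eig : Fin nJ → ℂ
  /-- the sizes of the Jordan blocks -/
  size : Fin nJ → ℕ
  /-- the sizes of the blocks at infinity -/
  α : Fin nα → ℕ
  /-- the column minimal indices, each increased by one -/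
  β : Fin nβ → ℕ
  /-- the row minimal indices, each increased by one -/
  γ : Fin nγ → ℕ
  size_pos : ∀ i, 0 < size i
  α_pos : ∀ i, 0 < α i
  β_pos : ∀ i, 0 < β i
  γ_pos : ∀ i, 0 < γ i

namespace Data

/-- The row indices of the canonical form. -/
abbrev Row (D : Data) : Type :=
  ((Σ i, Fin (D.size i)) ⊕ (Σ i, Fin (D.α i))) ⊕ ((Σ i, Fin (D.β i - 1)) ⊕ (Σ i, Fin (D.γ i)))

/-- The column indices of the canonical form. -/
abbrev Col (D : Data) : Type :=
  ((Σ i, Fin (D.size i)) ⊕ (Σ i, Fin (D.α i))) ⊕ ((Σ i, Fin (D.β i)) ⊕ (Σ i, Fin (D.γ i - 1)))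

/-- The leading coefficient `diag(I, N_α, K_β, K_γᵀ)` of the canonical form. -/
def matE (D : Data) : Matrix D.Row D.Col ℂ :=
  Matrix.fromBlocks
    (Matrix.fromBlocks 1 0 0 (Matrix.blockDiagonal' fun i => N (D.α i)))
    0 0
    (Matrix.fromBlocks (Matrix.blockDiagonal' fun i => K (D.β i)) 0 0
      (Matrix.blockDiagonal' fun i => K (D.γ i)).transpose)

/-- The matrix `diag(J₀, I, L_β, L_γᵀ)`, so that the canonical form is `s matE - matF`. -/
def matF (D : Data) : Matrix D.Row D.Col ℂ :=
  Matrix.fromBlocks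
    (Matrix.fromBlocks (Matrix.blockDiagonal' fun i => J (D.eig i) (D.size i)) 0 0 1)
    0 0
    (Matrix.fromBlocks (Matrix.blockDiagonal' fun i => L (D.β i)) 0 0
      (Matrix.blockDiagonal' fun i => L (D.γ i)).transpose)

/-- The Weyr characteristic read off from the canonical form: the conjugate partitions of the
Segre characteristics of `J₀` at its eigenvalues, and those of `α`, `β`, `γ`. -/
noncomputable def weyr (D : Data) : WeyrChar where
  w := fun μ k => Nat.card {i : Fin D.nJ // D.eig i = μ ∧ k + 1 ≤ D.size i}
  a := conj D.α
  b := conj D.β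
  c := conj D.γ

/-- The pencil `s E - F` has the Kronecker canonical form given by `D`: there are invertible
matrices `P`, `Q` such that `P (s E - F) Q` is the canonical form of `D`, after an identification
of its row and column indices with `Fin n` and `Fin m`. -/
def IsFormOf (D : Data) {n m : ℕ} (E F : Matrix (Fin n) (Fin m) ℂ) : Prop :=
  ∃ (r : D.Row ≃ Fin n) (c : D.Col ≃ Fin m)
    (P : Matrix (Fin n) (Fin n) ℂ) (Q : Matrix (Fin m) (Fin m) ℂ),
    IsUnit P ∧ IsUnit Q ∧
      ∀ s : ℂ, P * (s • E - F) * Q = Matrix.reindex r c (s • D.matE - D.matF)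

end Data

end Kronecker

/-- `ω` is the Weyr characteristic of the pencil `s E - F`, that is, it is read off from a
Kronecker canonical form of the pencil. -/
def IsPencilWeyr {n m : ℕ} (E F : Matrix (Fin n) (Fin m) ℂ) (ω : WeyrChar) : Prop :=
  ∃ D : Kronecker.Data, D.IsFormOf E F ∧ ω = D.weyr

/-! The relation `S` sees a pencil only up to a change of bases, and it turns direct sums of pencils
into direct sums of relations. Kernels, multivalued parts, domains, ranges, powers, root manifolds,
sums and intersections are all formed componentwise, so every entry of (W, A, B, C) is the sum of
its values on the blocks of a canonical form (`IsPi.quotDim_eq_sum`).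

On a single block the relation is essentially a coordinate shift. A Jordan block contributes only to
W, and only at its own eigenvalue; a block at infinity only to A; a column block, where the singular
chains fill the whole space, only to B; a row block only to C. For a row block of size k, the range
of the powers loses one dimension at each step, and C_j counts the block exactly when k ≥ j + 2.
Hence C_j = c_{j+2}. Row blocks of size 1 (no column) and of size 2 (the zero relation on a line)
leave no trace in (W, A, B, C), and c_1, c_2 come from counting: n - m = c_1 - b_1, and m = |w| +
|a| + |b| + ∑ (γ_i - 1), where the last sum is c_2 + |C|. Since `S`, n and m determine everything,
the result does not depend on the canonical form.

Existence of a form (`hasForm`) is by induction on the sum of the dimensions, splitting off direct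
summands (`HasForm.of_split`). A polynomial null vector of least degree spans a column block, and a
dual chain of functionals (`exists_dual_chain`) provides the complement; the dual pencil gives row
blocks in the same way. If there are no null vectors on either side, the pencil is square with
nonzero determinant, so F - cE is bijective for some c. Inverting it leads to the pair (M, 1 + cM),
which Fitting's decomposition divides into a nilpotent and an invertible part; both are decomposed
by Jordan chains of maximal length. -/

namespace Kronecker

/-! ## Canonical blocks and direct sums of blocks -/

/-- A block of the Kronecker canonical form. -/
inductive Block where
  | jordan (μ : ℂ) (k : ℕ)
  | infinite (k : ℕ)
  | column (k : ℕ)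
  | row (k : ℕ)

namespace Block

/-- The number of rows of a block. -/
def rows : Block → ℕ
  | jordan _ k => k
  | infinite k => k
  | column k => k - 1
  | row k => k

/-- The number of columns of a block. -/
def cols : Block → ℕ
  | jordan _ k => k
  | infinite k => k
  | column k => k
  | row k => k - 1

/-- The leading coefficient of a block. -/
def matE : (b : Block) → Matrix (Fin b.rows) (Fin b.cols) ℂ
  | jordan _ k => (1 : Matrix (Fin k) (Fin k) ℂ)
  | infinite k => N k
  | column k => K k
  | row k => (K k).transpose

/-- The matrix `F` of a block `s E - F`. -/
def matF : (b : Block) → Matrix (Fin b.rows) (Fin b.cols) ℂ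
  | jordan μ k => J μ k
  | infinite k => (1 : Matrix (Fin k) (Fin k) ℂ)
  | column k => L k
  | row k => (L k).transpose

/-- The size parameter of a block. -/
def param : Block → ℕ
  | jordan _ k => k
  | infinite k => k
  | column k => k
  | row k => k

end Block

/-- The pencil `s E - F` is, after a change of bases, the direct sum of the given blocks. -/
def FormedBy {ι X Y : Type*} [AddCommGroup X] [Module ℂ X] [AddCommGroup Y] [Module ℂ Y]
    (blk : ι → Block) (E F : X →ₗ[ℂ] Y) : Prop :=
  ∃ (eX : X ≃ₗ[ℂ] ((i : ι) → Fin (blk i).cols → ℂ))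
    (eY : Y ≃ₗ[ℂ] ((i : ι) → Fin (blk i).rows → ℂ)),
    (∀ x i, eY (E x) i = (blk i).matE.mulVec (eX x i)) ∧
      ∀ x i, eY (F x) i = (blk i).matF.mulVec (eX x i)

namespace FormedBy

variable {ι ι' X Y X' Y' : Type*} [AddCommGroup X] [Module ℂ X] [AddCommGroup Y] [Module ℂ Y]
  [AddCommGroup X'] [Module ℂ X'] [AddCommGroup Y'] [Module ℂ Y']
  {blk : ι → Block} {blk' : ι' → Block} {E F : X →ₗ[ℂ] Y} {E' F' : X' →ₗ[ℂ] Y'}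

theorem of_equiv (h : FormedBy blk E' F') (u : X ≃ₗ[ℂ] X') (v : Y ≃ₗ[ℂ] Y')
    (hE : ∀ x, E' (u x) = v (E x)) (hF : ∀ x, F' (u x) = v (F x)) : FormedBy blk E F := by
  obtain ⟨eX, eY, h1, h2⟩ := h
  refine ⟨u.trans eX, v.trans eY, fun x i => ?_, fun x i => ?_⟩
  · simp [← h1, hE]
  · simp [← h2, hF]

theorem reindex (h : FormedBy blk E F) (e : ι' ≃ ι) (he : ∀ i, blk' i = blk (e i)) :
    FormedBy blk' E F := by
  obtain rfl : blk' = fun i => blk (e i) := funext he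
  obtain ⟨eX, eY, h1, h2⟩ := h
  exact ⟨eX.trans (LinearEquiv.piCongrLeft ℂ (fun i => Fin (blk i).cols → ℂ) e).symm,
    eY.trans (LinearEquiv.piCongrLeft ℂ (fun i => Fin (blk i).rows → ℂ) e).symm,
    fun x i => h1 x (e i), fun x i => h2 x (e i)⟩

theorem prodMap (h : FormedBy blk E F) (h' : FormedBy blk' E' F') :
    FormedBy (Sum.elim blk blk') (E.prodMap E') (F.prodMap F') := by
  obtain ⟨eX, eY, h1, h2⟩ := h
  obtain ⟨eX', eY', h1', h2'⟩ := h'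
  refine ⟨(eX.prodCongr eX').trans
      (LinearEquiv.sumPiEquivProdPi ℂ ι ι' fun i => Fin (Sum.elim blk blk' i).cols → ℂ).symm,
    (eY.prodCongr eY').trans
      (LinearEquiv.sumPiEquivProdPi ℂ ι ι' fun i => Fin (Sum.elim blk blk' i).rows → ℂ).symm,
    ?_, ?_⟩
  · rintro ⟨x, x'⟩ (i | i)
    exacts [h1 x i, h1' x' i]
  · rintro ⟨x, x'⟩ (i | i)
    exacts [h2 x i, h2' x' i]

end FormedBy

/-! ### Direct sums of canonical forms -/

namespace Data

/-- The index type of the blocks of a canonical form. -/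
abbrev Idx (D : Data) : Type := (Fin D.nJ ⊕ Fin D.nα) ⊕ (Fin D.nβ ⊕ Fin D.nγ)

/-- The blocks of a canonical form. -/
def block (D : Data) : D.Idx → Block :=
  Sum.elim (Sum.elim (fun i => .jordan (D.eig i) (D.size i)) fun i => .infinite (D.α i))
    (Sum.elim (fun i => .column (D.β i)) fun i => .row (D.γ i))

/-- The canonical form without blocks. -/
def empty : Data where
  nJ := 0
  nα := 0
  nβ := 0
  nγ := 0
  eig := Fin.elim0
  size := Fin.elim0
  α := Fin.elim0
  β := Fin.elim0
  γ := Fin.elim0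
  size_pos i := i.elim0
  α_pos i := i.elim0
  β_pos i := i.elim0
  γ_pos i := i.elim0

theorem append_pos {k l : ℕ} {s : Fin k → ℕ} {t : Fin l → ℕ} (hs : ∀ i, 0 < s i)
    (ht : ∀ i, 0 < t i) (i : Fin (k + l)) : 0 < Fin.append s t i := by
  refine Fin.addCases (fun i => ?_) (fun i => ?_) i
  · simpa using hs i
  · simpa using ht i

/-- The direct sum of two canonical forms. -/
def add (D D' : Data) : Data where
  nJ := D.nJ + D'.nJ
  nα := D.nα + D'.nα
  nβ := D.nβ + D'.nβ
  nγ := D.nγ + D'.nγ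
  eig := Fin.append D.eig D'.eig
  size := Fin.append D.size D'.size
  α := Fin.append D.α D'.α
  β := Fin.append D.β D'.β
  γ := Fin.append D.γ D'.γ
  size_pos := append_pos D.size_pos D'.size_pos
  α_pos := append_pos D.α_pos D'.α_pos
  β_pos := append_pos D.β_pos D'.β_pos
  γ_pos := append_pos D.γ_pos D'.γ_pos

/-- The blocks of a direct sum are those of the summands. -/
def addIdxEquiv (D D' : Data) : D.Idx ⊕ D'.Idx ≃ (D.add D').Idx :=
  (Equiv.sumSumSumComm _ _ _ _).trans
    (Equiv.sumCongr
      ((Equiv.sumSumSumComm _ _ _ _).trans (Equiv.sumCongr finSumFinEquiv finSumFinEquiv))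
      ((Equiv.sumSumSumComm _ _ _ _).trans (Equiv.sumCongr finSumFinEquiv finSumFinEquiv)))

theorem block_addIdxEquiv (D D' : Data) (i : D.Idx ⊕ D'.Idx) :
    (D.add D').block (addIdxEquiv D D' i) = Sum.elim D.block D'.block i := by
  rcases i with ((i | i) | (i | i)) | ((i | i) | (i | i))
  · exact congrArg₂ Block.jordan (Fin.append_left ..) (Fin.append_left ..)
  · exact congrArg Block.infinite (Fin.append_left ..)
  · exact congrArg Block.column (Fin.append_left ..)
  · exact congrArg Block.row (Fin.append_left ..)
  · exact congrArg₂ Block.jordan (Fin.append_right ..) (Fin.append_right ..)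
  · exact congrArg Block.infinite (Fin.append_right ..)
  · exact congrArg Block.column (Fin.append_right ..)
  · exact congrArg Block.row (Fin.append_right ..)

end Data

/-- The pencil `s E - F` has a Kronecker canonical form. -/
def HasForm {X Y : Type*} [AddCommGroup X] [Module ℂ X] [AddCommGroup Y] [Module ℂ Y]
    (E F : X →ₗ[ℂ] Y) : Prop := ∃ D : Data, FormedBy D.block E F

namespace HasForm

variable {X Y X' Y' : Type*} [AddCommGroup X] [Module ℂ X] [AddCommGroup Y] [Module ℂ Y]
  [AddCommGroup X'] [Module ℂ X'] [AddCommGroup Y'] [Module ℂ Y']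
  {E F : X →ₗ[ℂ] Y} {E' F' : X' →ₗ[ℂ] Y'}

theorem of_equiv (h : HasForm E' F') (u : X ≃ₗ[ℂ] X') (v : Y ≃ₗ[ℂ] Y')
    (hE : ∀ x, E' (u x) = v (E x)) (hF : ∀ x, F' (u x) = v (F x)) : HasForm E F :=
  let ⟨D, hD⟩ := h
  ⟨D, hD.of_equiv u v hE hF⟩

theorem prodMap (h : HasForm E F) (h' : HasForm E' F') :
    HasForm (E.prodMap E') (F.prodMap F') :=
  let ⟨D, hD⟩ := h
  let ⟨D', hD'⟩ := h'
  ⟨D.add D', (hD.prodMap hD').reindex (Data.addIdxEquiv D D').symm fun i => by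
    rw [← Data.block_addIdxEquiv, Equiv.apply_symm_apply]⟩

theorem of_subsingleton [Subsingleton X] [Subsingleton Y] : HasForm E F := by
  have h1 : ∀ i : Data.empty.Idx, False := by
    rintro ((i | i) | (i | i)) <;> exact i.elim0
  refine ⟨Data.empty, ?_⟩
  have : IsEmpty Data.empty.Idx := ⟨h1⟩
  exact ⟨0, 0, fun x i => (h1 i).elim, fun x i => (h1 i).elim⟩

theorem of_unique {D : Data} [Unique D.Idx] {b : Block} (hb : D.block default = b) :
    HasForm b.matE.mulVecLin b.matF.mulVecLin := by
  subst hb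
  refine ⟨D, (LinearEquiv.piUnique ℂ fun i => Fin (D.block i).cols → ℂ).symm,
    (LinearEquiv.piUnique ℂ fun i => Fin (D.block i).rows → ℂ).symm, fun x i => ?_, fun x i => ?_⟩
  · obtain rfl := Unique.eq_default i
    simp
  · obtain rfl := Unique.eq_default i
    simp

theorem of_block (b : Block) (hb : 0 < b.param) : HasForm b.matE.mulVecLin b.matF.mulVecLin := by
  cases b with
  | jordan μ k =>
    let D : Data := { Data.empty with
      nJ := 1, eig := fun _ => μ, size := fun _ => k, size_pos := fun _ => hb }
    have : Unique D.Idx :=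
      { default := .inl (.inl 0)
        uniq := by
          rintro ((i | i) | (i | i))
          exacts [by rw [Fin.fin_one_eq_zero i], i.elim0, i.elim0, i.elim0] }
    exact of_unique (D := D) (by rw [this.uniq (.inl (.inl 0)) |>.symm]; rfl)
  | infinite k =>
    let D : Data := { Data.empty with nα := 1, α := fun _ => k, α_pos := fun _ => hb }
    have : Unique D.Idx :=
      { default := .inl (.inr 0)
        uniq := by
          rintro ((i | i) | (i | i))
          exacts [i.elim0, by rw [Fin.fin_one_eq_zero i], i.elim0, i.elim0] }
    exact of_unique (D := D) (by rw [this.uniq (.inl (.inr 0)) |>.symm]; rfl)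
  | column k =>
    let D : Data := { Data.empty with nβ := 1, β := fun _ => k, β_pos := fun _ => hb }
    have : Unique D.Idx :=
      { default := .inr (.inl 0)
        uniq := by
          rintro ((i | i) | (i | i))
          exacts [i.elim0, i.elim0, by rw [Fin.fin_one_eq_zero i], i.elim0] }
    exact of_unique (D := D) (by rw [this.uniq (.inr (.inl 0)) |>.symm]; rfl)
  | row k =>
    let D : Data := { Data.empty with nγ := 1, γ := fun _ => k, γ_pos := fun _ => hb }
    have : Unique D.Idx :=
      { default := .inr (.inr 0)
        uniq := by
          rintro ((i | i) | (i | i))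
          exacts [i.elim0, i.elim0, i.elim0, by rw [Fin.fin_one_eq_zero i]] }
    exact of_unique (D := D) (by rw [this.uniq (.inr (.inr 0)) |>.symm]; rfl)

end HasForm

/-! ## Splitting off a direct summand -/

section Split

variable {B X : Type*} [AddCommGroup B] [Module ℂ B] [FiniteDimensional ℂ B]
  [AddCommGroup X] [Module ℂ X] {i : B →ₗ[ℂ] X} {p : X →ₗ[ℂ] B}

/-- If `p ∘ i` is injective on the finite-dimensional space `B`, then `i` embeds `B` as a
complement of the kernel of `p`. -/
noncomputable def splitEquiv (h : Function.Injective (p ∘ₗ i)) :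
    (B × LinearMap.ker p) ≃ₗ[ℂ] X :=
  LinearEquiv.ofBijective (i.coprod (LinearMap.ker p).subtype) <| by
    constructor
    · rw [← LinearMap.ker_eq_bot, LinearMap.ker_eq_bot']
      rintro ⟨b, x, hx⟩ h0
      have h0' : i b + x = 0 := by simpa using h0
      have hx' : p x = 0 := hx
      have h1 : (p ∘ₗ i) b = 0 := by
        have := congrArg p h0'
        simpa [hx'] using this
      have hb : b = 0 := by
        apply h
        rw [h1, map_zero]
      subst hb
      have : x = 0 := by simpa using h0'
      subst this
      rfl
    · intro x
      -- An injective endomorphism of the finite-dimensional `B` is onto; `i b` is the component of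
      -- `x` in the summand.
      obtain ⟨b, hb⟩ := (LinearMap.injective_iff_surjective.mp h) (p x)
      refine ⟨(b, ⟨x - i b, ?_⟩), by simp⟩
      have hb' : p (i b) = p x := hb
      simp [hb']

@[simp]
theorem splitEquiv_apply (h : Function.Injective (p ∘ₗ i)) (z : B × LinearMap.ker p) :
    splitEquiv h z = i z.1 + z.2 := rfl

theorem finrank_ker_add_of_injective_comp [FiniteDimensional ℂ X]
    (h : Function.Injective (p ∘ₗ i)) :
    Module.finrank ℂ B + Module.finrank ℂ (LinearMap.ker p) = Module.finrank ℂ X := by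
  rw [← (splitEquiv h).finrank_eq, Module.finrank_prod]

end Split

/-- A pencil has a canonical form if a direct summand and its complement have. -/
theorem HasForm.of_split {B B' X Y : Type*} [AddCommGroup B] [Module ℂ B] [FiniteDimensional ℂ B]
    [AddCommGroup B'] [Module ℂ B'] [FiniteDimensional ℂ B']
    [AddCommGroup X] [Module ℂ X] [AddCommGroup Y] [Module ℂ Y]
    {E F : X →ₗ[ℂ] Y} {EB FB : B →ₗ[ℂ] B'} (hB : HasForm EB FB)
    (i : B →ₗ[ℂ] X) (p : X →ₗ[ℂ] B) (j : B' →ₗ[ℂ] Y) (q : Y →ₗ[ℂ] B')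
    (hiE : ∀ b, E (i b) = j (EB b)) (hiF : ∀ b, F (i b) = j (FB b))
    (hpE : ∀ x, q (E x) = EB (p x)) (hpF : ∀ x, q (F x) = FB (p x))
    (hp : Function.Injective (p ∘ₗ i)) (hq : Function.Injective (q ∘ₗ j))
    (hK : ∀ (hE : ∀ x ∈ LinearMap.ker p, E x ∈ LinearMap.ker q)
      (hF : ∀ x ∈ LinearMap.ker p, F x ∈ LinearMap.ker q),
      HasForm (E.restrict hE) (F.restrict hF)) : HasForm E F := by
  have hE : ∀ x ∈ LinearMap.ker p, E x ∈ LinearMap.ker q := by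
    intro x hx
    rw [LinearMap.mem_ker] at hx ⊢
    rw [hpE, hx, map_zero]
  have hF : ∀ x ∈ LinearMap.ker p, F x ∈ LinearMap.ker q := by
    intro x hx
    rw [LinearMap.mem_ker] at hx ⊢
    rw [hpF, hx, map_zero]
  refine (hB.prodMap (hK hE hF)).of_equiv (splitEquiv hp).symm (splitEquiv hq).symm ?_ ?_
  · intro x
    obtain ⟨z, rfl⟩ := (splitEquiv hp).surjective x
    rw [LinearEquiv.eq_symm_apply, LinearEquiv.symm_apply_apply]
    simp [hiE]
  · intro x
    obtain ⟨z, rfl⟩ := (splitEquiv hp).surjective x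
    rw [LinearEquiv.eq_symm_apply, LinearEquiv.symm_apply_apply]
    simp [hiF]

/-! ## Matrices -/

namespace Data

variable (D : Data)

/-- Vectors indexed by the columns of a canonical form, split into blocks. -/
def colEquiv : (D.Col → ℂ) ≃ₗ[ℂ] ((i : D.Idx) → Fin (D.block i).cols → ℂ) where
  toFun x
    | .inl (.inl i) => fun k => x (.inl (.inl ⟨i, k⟩))
    | .inl (.inr i) => fun k => x (.inl (.inr ⟨i, k⟩))
    | .inr (.inl i) => fun k => x (.inr (.inl ⟨i, k⟩))
    | .inr (.inr i) => fun k => x (.inr (.inr ⟨i, k⟩))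
  invFun y
    | .inl (.inl k) => y (.inl (.inl k.1)) k.2
    | .inl (.inr k) => y (.inl (.inr k.1)) k.2
    | .inr (.inl k) => y (.inr (.inl k.1)) k.2
    | .inr (.inr k) => y (.inr (.inr k.1)) k.2
  left_inv x := by
    ext ((k | k) | (k | k)) <;> rfl
  right_inv y := by
    funext i
    rcases i with ((i | i) | (i | i)) <;> rfl
  map_add' x y := by
    funext i
    rcases i with ((i | i) | (i | i)) <;> rfl
  map_smul' c y := by
    funext i
    rcases i with ((i | i) | (i | i)) <;> rfl

/-- Vectors indexed by the rows of a canonical form, split into blocks. -/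
def rowEquiv : (D.Row → ℂ) ≃ₗ[ℂ] ((i : D.Idx) → Fin (D.block i).rows → ℂ) where
  toFun x
    | .inl (.inl i) => fun k => x (.inl (.inl ⟨i, k⟩))
    | .inl (.inr i) => fun k => x (.inl (.inr ⟨i, k⟩))
    | .inr (.inl i) => fun k => x (.inr (.inl ⟨i, k⟩))
    | .inr (.inr i) => fun k => x (.inr (.inr ⟨i, k⟩))
  invFun y
    | .inl (.inl k) => y (.inl (.inl k.1)) k.2
    | .inl (.inr k) => y (.inl (.inr k.1)) k.2
    | .inr (.inl k) => y (.inr (.inl k.1)) k.2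
    | .inr (.inr k) => y (.inr (.inr k.1)) k.2
  left_inv x := by
    ext ((k | k) | (k | k)) <;> rfl
  right_inv y := by
    funext i
    rcases i with ((i | i) | (i | i)) <;> rfl
  map_add' x y := by
    funext i
    rcases i with ((i | i) | (i | i)) <;> rfl
  map_smul' c y := by
    funext i
    rcases i with ((i | i) | (i | i)) <;> rfl

theorem blockDiagonal'_mulVec {o : Type*} [Fintype o] [DecidableEq o] {m' n' : o → Type*}
    [∀ i, Fintype (n' i)] (M : ∀ i, Matrix (m' i) (n' i) ℂ) (x : (Σ i, n' i) → ℂ) (i : o)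
    (k : m' i) :
    (Matrix.blockDiagonal' M).mulVec x ⟨i, k⟩ = (M i).mulVec (fun l => x ⟨i, l⟩) k := by
  simp only [Matrix.mulVec, dotProduct, Fintype.sum_sigma]
  rw [Finset.sum_eq_single i]
  · simp
  · intro j _ hj
    refine Finset.sum_eq_zero fun l _ => ?_
    rw [Matrix.blockDiagonal'_apply_ne _ _ _ hj.symm, zero_mul]
  · simp

theorem blockDiagonal'_transpose_mulVec {o : Type*} [Fintype o] [DecidableEq o] {m' n' : o → Type*}
    [∀ i, Fintype (m' i)] (M : ∀ i, Matrix (m' i) (n' i) ℂ) (x : (Σ i, m' i) → ℂ) (i : o)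
    (k : n' i) :
    (Matrix.blockDiagonal' M).transpose.mulVec x ⟨i, k⟩
      = (M i).transpose.mulVec (fun l => x ⟨i, l⟩) k := by
  rw [Matrix.blockDiagonal'_transpose, blockDiagonal'_mulVec]

theorem matE_mulVec_jordan (x : D.Col → ℂ) (i : Fin D.nJ) (k : Fin (D.size i)) :
    D.matE.mulVec x (.inl <| .inl ⟨i, k⟩)
      = (1 : Matrix (Fin (D.size i)) (Fin (D.size i)) ℂ).mulVec (fun l => x (.inl <| .inl ⟨i, l⟩)) k := by
  rw [matE, Matrix.fromBlocks_mulVec, Matrix.fromBlocks_mulVec, Matrix.fromBlocks_mulVec]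
  simp

theorem matE_mulVec_infinite (x : D.Col → ℂ) (i : Fin D.nα) (k : Fin (D.α i)) :
    D.matE.mulVec x (.inl <| .inr ⟨i, k⟩)
      = (N (D.α i)).mulVec (fun l => x (.inl <| .inr ⟨i, l⟩)) k := by
  rw [matE, Matrix.fromBlocks_mulVec, Matrix.fromBlocks_mulVec, Matrix.fromBlocks_mulVec]
  simp only [Matrix.zero_mulVec, add_zero, zero_add, Sum.elim_inl, Sum.elim_inr]
  exact blockDiagonal'_mulVec (m' := fun i => Fin (D.α i)) (n' := fun i => Fin (D.α i))
    (fun i => N (D.α i)) (fun l => x (.inl <| .inr l)) i k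

theorem matE_mulVec_column (x : D.Col → ℂ) (i : Fin D.nβ) (k : Fin (D.β i - 1)) :
    D.matE.mulVec x (.inr <| .inl ⟨i, k⟩)
      = (K (D.β i)).mulVec (fun l => x (.inr <| .inl ⟨i, l⟩)) k := by
  rw [matE, Matrix.fromBlocks_mulVec, Matrix.fromBlocks_mulVec, Matrix.fromBlocks_mulVec]
  simp only [Matrix.zero_mulVec, add_zero, zero_add, Sum.elim_inl, Sum.elim_inr]
  exact blockDiagonal'_mulVec (m' := fun i => Fin (D.β i - 1)) (n' := fun i => Fin (D.β i))
    (fun i => K (D.β i)) (fun l => x (.inr <| .inl l)) i k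

theorem matE_mulVec_row (x : D.Col → ℂ) (i : Fin D.nγ) (k : Fin (D.γ i)) :
    D.matE.mulVec x (.inr <| .inr ⟨i, k⟩)
      = (K (D.γ i)).transpose.mulVec (fun l => x (.inr <| .inr ⟨i, l⟩)) k := by
  rw [matE, Matrix.fromBlocks_mulVec, Matrix.fromBlocks_mulVec, Matrix.fromBlocks_mulVec]
  simp only [Matrix.zero_mulVec, add_zero, zero_add, Sum.elim_inr]
  exact blockDiagonal'_transpose_mulVec
    (m' := fun i => Fin (D.γ i - 1)) (n' := fun i => Fin (D.γ i))
    (fun i => K (D.γ i)) (fun l => x (.inr <| .inr l)) i k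

theorem matF_mulVec_jordan (x : D.Col → ℂ) (i : Fin D.nJ) (k : Fin (D.size i)) :
    D.matF.mulVec x (.inl <| .inl ⟨i, k⟩)
      = (J (D.eig i) (D.size i)).mulVec (fun l => x (.inl <| .inl ⟨i, l⟩)) k := by
  rw [matF, Matrix.fromBlocks_mulVec, Matrix.fromBlocks_mulVec, Matrix.fromBlocks_mulVec]
  simp only [Matrix.zero_mulVec, add_zero, zero_add, Sum.elim_inl]
  exact blockDiagonal'_mulVec (m' := fun i => Fin (D.size i)) (n' := fun i => Fin (D.size i))
    (fun i => J (D.eig i) (D.size i)) (fun l => x (.inl <| .inl l)) i k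

theorem matF_mulVec_infinite (x : D.Col → ℂ) (i : Fin D.nα) (k : Fin (D.α i)) :
    D.matF.mulVec x (.inl <| .inr ⟨i, k⟩)
      = (1 : Matrix (Fin (D.α i)) (Fin (D.α i)) ℂ).mulVec (fun l => x (.inl <| .inr ⟨i, l⟩)) k := by
  rw [matF, Matrix.fromBlocks_mulVec, Matrix.fromBlocks_mulVec, Matrix.fromBlocks_mulVec]
  simp

theorem matF_mulVec_column (x : D.Col → ℂ) (i : Fin D.nβ) (k : Fin (D.β i - 1)) :
    D.matF.mulVec x (.inr <| .inl ⟨i, k⟩)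
      = (L (D.β i)).mulVec (fun l => x (.inr <| .inl ⟨i, l⟩)) k := by
  rw [matF, Matrix.fromBlocks_mulVec, Matrix.fromBlocks_mulVec, Matrix.fromBlocks_mulVec]
  simp only [Matrix.zero_mulVec, add_zero, zero_add, Sum.elim_inl, Sum.elim_inr]
  exact blockDiagonal'_mulVec (m' := fun i => Fin (D.β i - 1)) (n' := fun i => Fin (D.β i))
    (fun i => L (D.β i)) (fun l => x (.inr <| .inl l)) i k

theorem matF_mulVec_row (x : D.Col → ℂ) (i : Fin D.nγ) (k : Fin (D.γ i)) :
    D.matF.mulVec x (.inr <| .inr ⟨i, k⟩)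
      = (L (D.γ i)).transpose.mulVec (fun l => x (.inr <| .inr ⟨i, l⟩)) k := by
  rw [matF, Matrix.fromBlocks_mulVec, Matrix.fromBlocks_mulVec, Matrix.fromBlocks_mulVec]
  simp only [Matrix.zero_mulVec, add_zero, zero_add, Sum.elim_inr]
  exact blockDiagonal'_transpose_mulVec
    (m' := fun i => Fin (D.γ i - 1)) (n' := fun i => Fin (D.γ i))
    (fun i => L (D.γ i)) (fun l => x (.inr <| .inr l)) i k

theorem rowEquiv_matE_mulVec (x : D.Col → ℂ) (i : D.Idx) :
    D.rowEquiv (D.matE.mulVec x) i = (D.block i).matE.mulVec (D.colEquiv x i) := by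
  rcases i with ((i | i) | (i | i))
  · exact funext fun k => D.matE_mulVec_jordan x i k
  · exact funext fun k => D.matE_mulVec_infinite x i k
  · exact funext fun k => D.matE_mulVec_column x i k
  · exact funext fun k => D.matE_mulVec_row x i k

theorem rowEquiv_matF_mulVec (x : D.Col → ℂ) (i : D.Idx) :
    D.rowEquiv (D.matF.mulVec x) i = (D.block i).matF.mulVec (D.colEquiv x i) := by
  rcases i with ((i | i) | (i | i))
  · exact funext fun k => D.matF_mulVec_jordan x i k
  · exact funext fun k => D.matF_mulVec_infinite x i k
  · exact funext fun k => D.matF_mulVec_column x i k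
  · exact funext fun k => D.matF_mulVec_row x i k

theorem isFormOf_of_formedBy {n m : ℕ} {E F : Matrix (Fin n) (Fin m) ℂ}
    (h : FormedBy D.block E.mulVecLin F.mulVecLin) : D.IsFormOf E F := by
  obtain ⟨eX, eY, hE, hF⟩ := h
  let f : (Fin m → ℂ) ≃ₗ[ℂ] (D.Col → ℂ) := eX.trans D.colEquiv.symm
  let g : (Fin n → ℂ) ≃ₗ[ℂ] (D.Row → ℂ) := eY.trans D.rowEquiv.symm
  have hgE : ∀ x, g (E.mulVec x) = D.matE.mulVec (f x) := by
    intro x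
    apply D.rowEquiv.injective
    funext i
    rw [rowEquiv_matE_mulVec]
    simpa [f, g] using hE x i
  have hgF : ∀ x, g (F.mulVec x) = D.matF.mulVec (f x) := by
    intro x
    apply D.rowEquiv.injective
    funext i
    rw [rowEquiv_matF_mulVec]
    simpa [f, g] using hF x i
  have hc : Fintype.card D.Col = Fintype.card (Fin m) := by
    simpa [-Fintype.card_sum] using f.finrank_eq.symm
  have hr : Fintype.card D.Row = Fintype.card (Fin n) := by
    simpa [-Fintype.card_sum] using g.finrank_eq.symm
  -- Any numbering of the rows and columns will do, since the transforming matrices absorb it.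
  let c := Fintype.equivOfCardEq hc
  let r := Fintype.equivOfCardEq hr
  let q : (Fin m → ℂ) ≃ₗ[ℂ] (Fin m → ℂ) := (LinearEquiv.funCongrLeft ℂ ℂ c).trans f.symm
  let p : (Fin n → ℂ) ≃ₗ[ℂ] (Fin n → ℂ) := g.trans (LinearEquiv.funCongrLeft ℂ ℂ r.symm)
  refine ⟨r, c, LinearMap.toMatrix' p.toLinearMap, LinearMap.toMatrix' q.toLinearMap, ?_, ?_, ?_⟩
  · exact (LinearEquiv.isUnit_det' p).elim fun u hu => by
      rw [Matrix.isUnit_iff_isUnit_det, LinearMap.det_toMatrix', ← hu]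
      exact u.isUnit
  · exact (LinearEquiv.isUnit_det' q).elim fun u hu => by
      rw [Matrix.isUnit_iff_isUnit_det, LinearMap.det_toMatrix', ← hu]
      exact u.isUnit
  · intro s
    apply Matrix.toLin'.injective
    refine LinearMap.ext fun x => ?_
    have h1 : (s • E - F).mulVec (q x) = s • E.mulVec (q x) - F.mulVec (q x) := by
      rw [Matrix.sub_mulVec, Matrix.smul_mulVec]
    have h2 : g ((s • E - F).mulVec (q x)) = (s • D.matE - D.matF).mulVec (fun k => x (c k)) := by
      rw [h1, map_sub, map_smul, hgE, hgF, Matrix.sub_mulVec, Matrix.smul_mulVec]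
      have : f (q x) = fun k => x (c k) := by
        simp only [q, LinearEquiv.trans_apply, LinearEquiv.apply_symm_apply]
        rfl
      rw [this]
    simp only [Matrix.toLin'_apply, ← Matrix.mulVec_mulVec, LinearMap.toMatrix'_mulVec]
    change (fun k => g ((s • E - F).mulVec (q x)) (r.symm k)) = _
    rw [h2]
    ext k
    simp only [Matrix.reindex_apply, Matrix.mulVec, dotProduct, Matrix.submatrix_apply]
    exact Fintype.sum_equiv c _ _ fun k => by simp

theorem formedBy_of_isFormOf {n m : ℕ} {E F : Matrix (Fin n) (Fin m) ℂ}
    (h : D.IsFormOf E F) : FormedBy D.block E.mulVecLin F.mulVecLin := by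
  obtain ⟨r, c, P, Q, hP, hQ, h⟩ := h
  have hPdet := (Matrix.isUnit_iff_isUnit_det _).mp hP
  have hQdet := (Matrix.isUnit_iff_isUnit_det _).mp hQ
  -- The pencil identity at s = 0 and s = 1 separates the two coefficients.
  have hF : P * F * Q = Matrix.reindex r c D.matF := by
    have := h 0
    simp only [zero_smul, zero_sub, Matrix.mul_neg, Matrix.neg_mul] at this
    exact neg_injective this
  have hE : P * E * Q = Matrix.reindex r c D.matE := by
    have h1 := h 1
    have : P * E * Q - P * F * Q = Matrix.reindex r c D.matE - Matrix.reindex r c D.matF := by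
      rw [← Matrix.sub_mul, ← Matrix.mul_sub]
      simp only [one_smul] at h1
      exact h1
    rwa [hF, sub_left_inj] at this
  let f : (Fin m → ℂ) ≃ₗ[ℂ] (D.Col → ℂ) :=
    (Matrix.toLinearEquiv' Q hQ.invertible).symm.trans (LinearEquiv.funCongrLeft ℂ ℂ c)
  let g : (Fin n → ℂ) ≃ₗ[ℂ] (D.Row → ℂ) :=
    (Matrix.toLinearEquiv' P hP.invertible).trans (LinearEquiv.funCongrLeft ℂ ℂ r)
  have key : ∀ (A : Matrix (Fin n) (Fin m) ℂ) (B : Matrix D.Row D.Col ℂ),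
      P * A * Q = Matrix.reindex r c B → ∀ x, g (A.mulVec x) = B.mulVec (f x) := by
    intro A B hAB x
    obtain ⟨x, rfl⟩ : ∃ x', x = Q.mulVec x' := ⟨Q⁻¹.mulVec x, by
      rw [Matrix.mulVec_mulVec, Matrix.mul_nonsing_inv _ hQdet, Matrix.one_mulVec]⟩
    have hfx : f (Q.mulVec x) = fun k => x (c k) := by
      have : (Matrix.toLinearEquiv' Q hQ.invertible).symm (Q.mulVec x) = x := by
        rw [LinearEquiv.symm_apply_eq]
        rfl
      funext k
      exact congrFun this (c k)
    have hg : g (A.mulVec (Q.mulVec x)) = fun k => (P * A * Q).mulVec x (r k) := by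
      funext k
      rw [← Matrix.mulVec_mulVec, ← Matrix.mulVec_mulVec]
      rfl
    rw [hfx, hg, hAB]
    ext k
    simp only [Matrix.reindex_apply, Matrix.mulVec, dotProduct, Matrix.submatrix_apply]
    exact Fintype.sum_equiv c.symm _ _ fun k => by simp
  refine ⟨f.trans D.colEquiv, g.trans D.rowEquiv, fun x i => ?_, fun x i => ?_⟩
  · simp only [LinearEquiv.trans_apply, Matrix.mulVecLin_apply]
    rw [key E _ hE, rowEquiv_matE_mulVec]
  · simp only [LinearEquiv.trans_apply, Matrix.mulVecLin_apply]
    rw [key F _ hF, rowEquiv_matF_mulVec]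

end Data

/-! ## Chains of vectors and functionals -/

section Chains

variable {X Y : Type*} [AddCommGroup X] [Module ℂ X] [AddCommGroup Y] [Module ℂ Y]

/-- Supplies the intertwining hypotheses of `HasForm.of_split`: a block is embedded by prescribing
the images of the unit vectors, so only these have to be checked. -/
theorem linearCombination_mulVec {ι κ : Type*} [Fintype ι] [Fintype κ]
    {E : X →ₗ[ℂ] Y} {g : ι → X} {h : κ → Y} {M : Matrix κ ι ℂ}
    (H : ∀ j, E (g j) = ∑ r, M r j • h r) (v : ι → ℂ) :
    E (Fintype.linearCombination ℂ g v) = Fintype.linearCombination ℂ h (M.mulVecLin v) := by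
  simp only [Fintype.linearCombination_apply, map_sum, map_smul, H, Finset.smul_sum,
    Matrix.mulVecLin_apply, Matrix.mulVec, dotProduct, Finset.sum_smul]
  rw [Finset.sum_comm]
  refine Finset.sum_congr rfl fun r _ => Finset.sum_congr rfl fun j _ => ?_
  rw [smul_smul, mul_comm]

theorem sum_ite_val_eq_smul (n a : ℕ) (h : ℕ → X) :
    ∑ r : Fin n, (if (r : ℕ) = a then (1 : ℂ) else 0) • h r = if a < n then h a else 0 := by
  split_ifs with ha
  · rw [Finset.sum_eq_single (⟨a, ha⟩ : Fin n)]
    · simp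
    · intro b _ hb
      rw [if_neg (fun hh => hb (Fin.ext hh)), zero_smul]
    · simp
  · refine Finset.sum_eq_zero fun r _ => ?_
    rw [if_neg (by have := r.2; omega), zero_smul]

/-- The composite is multiplication by the matrix of the pairings `φ r (g l)`. In the applications
this matrix is triangular, so that linear independence of the chains need not be shown separately.
-/
theorem injective_of_det_ne_zero {n : ℕ} {g : Fin n → X} {φ : Fin n → X →ₗ[ℂ] ℂ}
    (h : (Matrix.of fun r l => φ r (g l)).det ≠ 0) :
    Function.Injective (LinearMap.pi φ ∘ₗ Fintype.linearCombination ℂ g) := by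
  have : LinearMap.pi φ ∘ₗ Fintype.linearCombination ℂ g
      = (Matrix.of fun r l => φ r (g l)).mulVecLin := by
    refine LinearMap.ext fun v => funext fun r => ?_
    simp [Fintype.linearCombination_apply, Matrix.mulVec, dotProduct, mul_comm]
  rw [this]
  exact Matrix.mulVec_injective_of_isUnit
    ((Matrix.isUnit_iff_isUnit_det _).mpr (isUnit_iff_ne_zero.mpr h))

theorem injective_of_lower {n : ℕ} {g : Fin n → X} {φ : Fin n → X →ₗ[ℂ] ℂ}
    (h0 : ∀ r l, r < l → φ r (g l) = 0) (h1 : ∀ r, φ r (g r) ≠ 0) :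
    Function.Injective (LinearMap.pi φ ∘ₗ Fintype.linearCombination ℂ g) := by
  apply injective_of_det_ne_zero
  rw [Matrix.det_of_isLowerTriangular]
  · exact Finset.prod_ne_zero_iff.mpr fun r _ => h1 r
  · intro r l hrl
    exact h0 r l (by simpa using hrl)

theorem injective_of_upper {n : ℕ} {g : Fin n → X} {φ : Fin n → X →ₗ[ℂ] ℂ}
    (h0 : ∀ r l, l < r → φ r (g l) = 0) (h1 : ∀ r, φ r (g r) ≠ 0) :
    Function.Injective (LinearMap.pi φ ∘ₗ Fintype.linearCombination ℂ g) := by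
  apply injective_of_det_ne_zero
  rw [Matrix.det_of_isUpperTriangular]
  · exact Finset.prod_ne_zero_iff.mpr fun r _ => h1 r
  · intro r l hrl
    exact h0 r l (by simpa using hrl)

/-- The coefficients of a polynomial null vector of degree less than `k` of the pencil
`s E - F`. -/
structure IsNullChain (E F : X →ₗ[ℂ] Y) (k : ℕ) (x : ℕ → X) : Prop where
  map_zero : F (x 0) = 0
  map_succ : ∀ i, E (x i) = F (x (i + 1))
  eq_zero : ∀ i, k ≤ i → x i = 0

/-- A null chain of minimal length has a dual chain of functionals. -/
theorem exists_dual_chain {E F : X →ₗ[ℂ] Y} (h : ∃ k x, IsNullChain E F k x ∧ x ≠ 0) :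
    ∃ (k : ℕ) (x : ℕ → X) (φ : ℕ → X →ₗ[ℂ] ℂ) (ψ : ℕ → Y →ₗ[ℂ] ℂ), 0 < k ∧ IsNullChain E F k x ∧
      (∀ j, j + 1 < k → φ j = ψ j ∘ₗ E ∧ φ (j + 1) = ψ j ∘ₗ F) ∧
      (∀ j < k, φ j (x j) ≠ 0) ∧ ∀ j < k, ∀ l < k, j ≠ l → φ j (x l) = 0 := by
  classical
  set k := Nat.find h with hk
  obtain ⟨x, hx, hx0⟩ := Nat.find_spec h
  rw [← hk] at hx
  have hmin : ∀ l < k, ∀ y, IsNullChain E F l y → y = 0 := by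
    intro l hl y hy
    by_contra h0
    exact Nat.find_min h hl ⟨y, hy, h0⟩
  have hkpos : 0 < k := by
    rcases Nat.eq_zero_or_pos k with h0 | h0
    · exact absurd (funext fun i => hx.eq_zero i (by omega)) hx0
    · exact h0
  -- Otherwise dropping the first vector leaves a shorter nonzero chain.
  have hx00 : x 0 ≠ 0 := by
    intro h0
    have := hmin (k - 1) (by omega) (fun i => x (i + 1))
      ⟨by rw [← hx.map_succ, h0, map_zero], fun i => hx.map_succ (i + 1),
        fun i hi => hx.eq_zero _ (by omega)⟩
    apply hx0
    funext i
    cases i with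
    | zero => exact h0
    | succ i => exact congrFun this i
  obtain ⟨φ, ψ, h1, h2⟩ : ∃ (φ : ℕ → X →ₗ[ℂ] ℂ) (ψ : ℕ → Y →ₗ[ℂ] ℂ),
      (∀ j, j + 1 < k → φ j = ψ j ∘ₗ E ∧ φ (j + 1) = ψ j ∘ₗ F) ∧ φ 0 (x 0) ≠ 0 := by
    obtain hk1 | ⟨q, hq⟩ : k = 1 ∨ ∃ q, k = q + 2 := by
      rcases k with _ | _ | q
      · omega
      · exact .inl rfl
      · exact .inr ⟨q, rfl⟩
    -- A chain of length one imposes no condition on `ψ`; any functional that does not vanish at `x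
    -- 0` serves.
    · obtain ⟨f, hf, -⟩ := Submodule.exists_le_ker_of_notMem (K := ℂ) (p := ⊥) (v := x 0)
        (by simpa using hx00)
      exact ⟨fun _ => f, 0, fun j hj => by omega, hf⟩
    -- The functionals `ψ 0`, ..., `ψ q` are sought as the components of one functional `Ψ` on
    -- finitely supported sequences in `Y`. The conditions `ψ i ∘ₗ F = ψ (i + 1) ∘ₗ E` for `i < q`
    -- say exactly that `Ψ` kills the image under `T` of the sequences supported below `q`.
    · let T : (ℕ →₀ X) →ₗ[ℂ] (ℕ →₀ Y) := Finsupp.lsum ℂ fun i =>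
        Finsupp.lsingle i ∘ₗ F - Finsupp.lsingle (i + 1) ∘ₗ E
      have hT : ∀ i z, T (Finsupp.single i z)
          = Finsupp.single i (F z) - Finsupp.single (i + 1) (E z) := by
        intro i z
        simp [T]
      have hT0 : ∀ z, T z 0 = F (z 0) := by
        intro z
        induction z using Finsupp.induction_linear with
        | zero => simp
        | add f g hf hg => simp [hf, hg]
        | single i z =>
          rw [hT]
          cases i <;> simp
      have hTs : ∀ z i, T z (i + 1) = F (z (i + 1)) - E (z i) := by
        intro z l
        induction z using Finsupp.induction_linear with
        | zero => simp
        | add f g hf hg => simp [hf, hg]; abel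
        | single i z =>
          rw [hT]
          simp only [Finsupp.coe_sub, Pi.sub_apply, Finsupp.single_apply, add_left_inj]
          split_ifs <;> simp
      -- A preimage `z` would make `x 0, z 0, z 1, ...` a nonzero null chain of length `q + 1 < k`,
      -- against minimality.
      have hnot : Finsupp.single 0 (E (x 0)) ∉
          (Finsupp.supported X ℂ {i | i < q}).map T := by
        rintro ⟨z, hz, hTz⟩
        have h0 := hT0 z
        rw [hTz, Finsupp.single_eq_same] at h0
        have hw := hmin (q + 1) (by omega) (fun i => Nat.casesOn i (x 0) z)
          ⟨hx.map_zero, fun i => ?_, fun i hi => ?_⟩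
        · exact hx00 (congrFun hw 0)
        · cases i with
          | zero => exact h0
          | succ i =>
            have := hTs z i
            rw [hTz] at this
            simp only [Finsupp.single_apply] at this
            rw [if_neg (by omega)] at this
            exact (sub_eq_zero.mp this.symm).symm
        · cases i with
          | zero => omega
          | succ i =>
            by_contra hne
            have : i ∈ z.support := Finsupp.mem_support_iff.mpr hne
            have := (Finsupp.mem_supported ℂ z).mp hz this
            simp only [Set.mem_ofPred_eq] at this
            omega
      obtain ⟨Ψ, hΨ, hker⟩ := Submodule.exists_le_ker_of_notMem hnot
      have hΨ' : ∀ i < q, ∀ z, Ψ (Finsupp.single i (F z)) = Ψ (Finsupp.single (i + 1) (E z)) := by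
        intro i hi z
        have : T (Finsupp.single i z) ∈ LinearMap.ker Ψ :=
          hker ⟨_, Finsupp.single_mem_supported ℂ z hi, rfl⟩
        rw [hT, LinearMap.mem_ker, map_sub, sub_eq_zero] at this
        exact this
      refine ⟨fun j => Nat.casesOn j (Ψ ∘ₗ Finsupp.lsingle 0 ∘ₗ E)
        fun j => Ψ ∘ₗ Finsupp.lsingle j ∘ₗ F,
        fun j => Ψ ∘ₗ Finsupp.lsingle j, fun j hj => ⟨?_, rfl⟩, hΨ⟩
      cases j with
      | zero => rfl
      | succ j => exact LinearMap.ext fun z => hΨ' j (by omega) z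
  -- The matrix of pairings is constant along diagonals. The main diagonal carries the nonzero value
  -- `φ 0 (x 0)`.
  have hstep : ∀ j, j + 1 < k → ∀ l, φ (j + 1) (x (l + 1)) = φ j (x l) := by
    intro j hj l
    rw [(h1 j hj).1, (h1 j hj).2, LinearMap.comp_apply, LinearMap.comp_apply, hx.map_succ]
  refine ⟨k, x, φ, ψ, hkpos, hx, h1, ?_, ?_⟩
  · intro j hj
    induction j with
    | zero => exact h2
    | succ j ih =>
      rw [hstep j hj]
      exact ih (by omega)
  · intro j hj l hl hjl
    rcases Nat.lt_or_gt_of_ne hjl with hlt | hlt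
    -- Above the diagonal, move along it to the last vector, where `E (x (k - 1)) = F (x k) = 0`.
    · obtain ⟨d, hd⟩ : ∃ d, l + d = k - 1 := ⟨k - 1 - l, by omega⟩
      clear hjl
      induction d generalizing j l with
      | zero =>
        rw [(h1 j (by omega)).1, LinearMap.comp_apply, hx.map_succ, hx.eq_zero (l + 1) (by omega)]
        simp
      | succ d ih =>
        rw [← hstep j (by omega)]
        exact ih (j + 1) (by omega) (l + 1) (by omega) (by omega) (by omega)
    -- Below the diagonal, move back to the first vector, where `F (x 0) = 0`.
    · clear hjl
      induction l generalizing j with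
      | zero =>
        obtain ⟨j, rfl⟩ : ∃ i, j = i + 1 := ⟨j - 1, by omega⟩
        rw [(h1 j hj).2, LinearMap.comp_apply, hx.map_zero, map_zero]
      | succ l ih =>
        obtain ⟨j, rfl⟩ : ∃ i, j = i + 1 := ⟨j - 1, by omega⟩
        rw [hstep j hj]
        apply ih <;> omega

end Chains

/-! ## Splitting off singular blocks -/

section Singular

variable {X Y : Type} [AddCommGroup X] [Module ℂ X] [AddCommGroup Y] [Module ℂ Y]
  [FiniteDimensional ℂ X] [FiniteDimensional ℂ Y] {E F : X →ₗ[ℂ] Y}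

/-- All smaller pencils have a canonical form. -/
def SmallerHaveForm (X Y : Type) [AddCommGroup X] [Module ℂ X] [AddCommGroup Y]
    [Module ℂ Y] : Prop :=
  ∀ (X' Y' : Type) [AddCommGroup X'] [Module ℂ X'] [AddCommGroup Y'] [Module ℂ Y']
    [FiniteDimensional ℂ X'] [FiniteDimensional ℂ Y'] (E' F' : X' →ₗ[ℂ] Y'),
    Module.finrank ℂ X' + Module.finrank ℂ Y' < Module.finrank ℂ X + Module.finrank ℂ Y →
      HasForm E' F'

/-- Here `g`, `h` embed the block and `φ`, `ψ` project onto it, so the common kernels of the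
functionals form a complementary pencil of smaller total dimension. -/
theorem HasForm.of_split_block (b : Block) (hb : 0 < b.param) (IH : SmallerHaveForm X Y)
    (g : Fin b.cols → X) (φ : Fin b.cols → X →ₗ[ℂ] ℂ)
    (h : Fin b.rows → Y) (ψ : Fin b.rows → Y →ₗ[ℂ] ℂ)
    (hgE : ∀ j, E (g j) = ∑ r, b.matE r j • h r) (hgF : ∀ j, F (g j) = ∑ r, b.matF r j • h r)
    (hφE : ∀ r, ψ r ∘ₗ E = ∑ j, b.matE r j • φ j) (hφF : ∀ r, ψ r ∘ₗ F = ∑ j, b.matF r j • φ j)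
    (hp : Function.Injective (LinearMap.pi φ ∘ₗ Fintype.linearCombination ℂ g))
    (hq : Function.Injective (LinearMap.pi ψ ∘ₗ Fintype.linearCombination ℂ h)) :
    HasForm E F := by
  refine HasForm.of_split (HasForm.of_block b hb) _ _ _ _ (linearCombination_mulVec hgE)
    (linearCombination_mulVec hgF) (fun x => ?_) (fun x => ?_) hp hq fun hE hF => IH _ _ _ _ ?_
  · funext r
    have := LinearMap.congr_fun (hφE r) x
    simpa [Matrix.mulVec, dotProduct] using this
  · funext r
    have := LinearMap.congr_fun (hφF r) x
    simpa [Matrix.mulVec, dotProduct] using this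
  · have h1 := finrank_ker_add_of_injective_comp hp
    have h2 := finrank_ker_add_of_injective_comp hq
    simp only [Module.finrank_fintype_fun_eq_card, Fintype.card_fin] at h1 h2
    -- A singular block of size 1 has no rows or no columns, so only the sum is positive; hence the
    -- induction on the sum of the dimensions.
    have : 0 < b.cols + b.rows := by
      cases b <;> simp only [Block.cols, Block.rows, Block.param] at * <;> omega
    omega

/-- The vectors `x j` and their images `E (x j)` span a column block. The dual chain pairs with both
families through a diagonal matrix with nonzero diagonal. -/
theorem HasForm.of_nullChain (IH : SmallerHaveForm X Y)
    (h : ∃ k x, IsNullChain E F k x ∧ x ≠ 0) : HasForm E F := by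
  obtain ⟨k, x, φ, ψ, hk, hx, hφψ, hd, h0⟩ := exists_dual_chain h
  have hψ : ∀ r, r + 1 < k → ∀ l, ψ r (E (x l)) = φ r (x l) := by
    intro r hr l
    rw [(hφψ r hr).1, LinearMap.comp_apply]
  refine HasForm.of_split_block (.column k) hk IH (fun j : Fin k => x j) (fun j : Fin k => φ j)
    (fun j : Fin (k - 1) => E (x j)) (fun j : Fin (k - 1) => ψ j) ?_ ?_ ?_ ?_ ?_ ?_
  · intro (j : Fin k)
    change _ = ∑ r : Fin (k - 1), (if (j : ℕ) = r then (1 : ℂ) else 0) • E (x r)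
    simp_rw [eq_comm (a := (j : ℕ))]
    rw [sum_ite_val_eq_smul (k - 1) j fun r => E (x r)]
    split_ifs with hj
    · rfl
    -- The last vector of the chain is the zero column of `K k`.
    · rw [hx.map_succ, hx.eq_zero _ (by omega), map_zero]
  · intro (j : Fin k)
    change _ = ∑ r : Fin (k - 1), (if (j : ℕ) = r + 1 then (1 : ℂ) else 0) • E (x r)
    obtain ⟨j, hj⟩ := j
    cases j with
    | zero => simpa using hx.map_zero
    | succ j =>
      simp only [add_left_inj, eq_comm (a := j)]
      rw [sum_ite_val_eq_smul (k - 1) j fun r => E (x r), if_pos (by omega), hx.map_succ]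
  · intro (r : Fin (k - 1))
    change _ = ∑ j : Fin k, (if (j : ℕ) = r then (1 : ℂ) else 0) • φ j
    rw [sum_ite_val_eq_smul k r φ, if_pos (by omega), (hφψ r (by omega)).1]
  · intro (r : Fin (k - 1))
    change _ = ∑ j : Fin k, (if (j : ℕ) = r + 1 then (1 : ℂ) else 0) • φ j
    rw [sum_ite_val_eq_smul k (r + 1) φ, if_pos (by omega), (hφψ r (by omega)).2]
  · exact injective_of_lower (fun r l hrl => h0 r r.2 l l.2 (Fin.val_ne_of_ne hrl.ne))
      fun r => hd r r.2
  · refine injective_of_lower (n := k - 1) (fun r l hrl => ?_) fun r => ?_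
    · rw [hψ r (by omega)]
      exact h0 r (by omega) l (by omega) (Fin.val_ne_of_ne hrl.ne)
    · rw [hψ r (by omega)]
      exact hd r (by omega)

/-- The transposed argument: the chain now consists of functionals on `Y`, and by reflexivity the
dual chain of functionals on the dual spaces consists of evaluations at vectors `x j`, `y j`. -/
theorem HasForm.of_dual_nullChain (IH : SmallerHaveForm X Y)
    (h : ∃ k x, IsNullChain E.dualMap F.dualMap k x ∧ x ≠ 0) : HasForm E F := by
  obtain ⟨k, ξ, φ, ψ, hk, hξ, hφψ, hd, h0⟩ := exists_dual_chain h
  let y : ℕ → Y := fun j => (Module.evalEquiv ℂ Y).symm (φ j)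
  let x : ℕ → X := fun j => (Module.evalEquiv ℂ X).symm (ψ j)
  have hy : ∀ j (f : Module.Dual ℂ Y), f (y j) = φ j f := fun j f =>
    Module.apply_evalEquiv_symm_apply (R := ℂ) (M := Y) f (φ j)
  have hx : ∀ j (f : Module.Dual ℂ X), f (x j) = ψ j f := fun j f =>
    Module.apply_evalEquiv_symm_apply (R := ℂ) (M := X) f (ψ j)
  have hxE : ∀ j, j + 1 < k → E (x j) = y j := by
    intro j hj
    refine (Module.evalEquiv ℂ Y).injective (LinearMap.ext fun f => ?_)
    change f _ = f _
    rw [hy, (hφψ j hj).1]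
    exact hx j (f ∘ₗ E)
  have hxF : ∀ j, j + 1 < k → F (x j) = y (j + 1) := by
    intro j hj
    refine (Module.evalEquiv ℂ Y).injective (LinearMap.ext fun f => ?_)
    change f _ = f _
    rw [hy, (hφψ j hj).2]
    exact hx j (f ∘ₗ F)
  have hξ0 : ξ 0 ∘ₗ F = 0 := hξ.map_zero
  have hξs : ∀ i, ξ i ∘ₗ E = ξ (i + 1) ∘ₗ F := hξ.map_succ
  refine HasForm.of_split_block (.row k) hk IH (fun j : Fin (k - 1) => x j)
    (fun j : Fin (k - 1) => ξ j ∘ₗ E) (fun j : Fin k => y j) (fun j : Fin k => ξ j)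
    ?_ ?_ ?_ ?_ ?_ ?_
  · intro (j : Fin (k - 1))
    change _ = ∑ r : Fin k, (if (r : ℕ) = j then (1 : ℂ) else 0) • y r
    rw [sum_ite_val_eq_smul k j y, if_pos (by omega), hxE j (by omega)]
  · intro (j : Fin (k - 1))
    change _ = ∑ r : Fin k, (if (r : ℕ) = j + 1 then (1 : ℂ) else 0) • y r
    rw [sum_ite_val_eq_smul k (j + 1) y, if_pos (by omega), hxF j (by omega)]
  · intro (r : Fin k)
    change _ = ∑ j : Fin (k - 1), (if (r : ℕ) = j then (1 : ℂ) else 0) • (ξ j ∘ₗ E)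
    simp_rw [eq_comm (a := (r : ℕ))]
    rw [sum_ite_val_eq_smul (k - 1) r fun j => ξ j ∘ₗ E]
    split_ifs with hr
    · rfl
    · change ξ r ∘ₗ E = 0
      rw [hξs, hξ.eq_zero _ (by omega), LinearMap.zero_comp]
  · intro (r : Fin k)
    change _ = ∑ j : Fin (k - 1), (if (r : ℕ) = j + 1 then (1 : ℂ) else 0) • (ξ j ∘ₗ E)
    obtain ⟨r, hr⟩ := r
    cases r with
    | zero => simpa using hξ0
    | succ r =>
      simp only [add_left_inj, eq_comm (a := r)]
      rw [sum_ite_val_eq_smul (k - 1) r fun j => ξ j ∘ₗ E, if_pos (by omega), hξs]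
  · refine injective_of_lower (n := k - 1) (fun r l hrl => ?_) fun r => ?_
    · rw [LinearMap.comp_apply, hxE l (by omega), hy]
      exact h0 l (by omega) r (by omega) (Fin.val_ne_of_ne hrl.ne')
    · rw [LinearMap.comp_apply, hxE r (by omega), hy]
      exact hd r (by omega)
  · refine injective_of_lower (n := k) (fun r l hrl => ?_) fun r => ?_
    · rw [hy]
      exact h0 l (by omega) r (by omega) (Fin.val_ne_of_ne hrl.ne')
    · rw [hy]
      exact hd r (by omega)

end Singular

/-! ## Regular pencils -/

section Endomorphism

/-- A Jordan chain of maximal length at the eigenvalue `0`, and a functional detecting it. -/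
theorem exists_jordan_chain {X : Type*} [AddCommGroup X] [Module ℂ X] [FiniteDimensional ℂ X]
    {T : Module.End ℂ X} (hT : LinearMap.ker T ≠ ⊥) :
    ∃ (k : ℕ) (x : X) (f : X →ₗ[ℂ] ℂ), (T ^ (k + 1)) x = 0 ∧ f ∘ₗ (T ^ (k + 1)) = 0 ∧
      f ((T ^ k) x) ≠ 0 := by
  classical
  set d := Module.finrank ℂ X
  -- The least exponent at which the kernels become stationary is the length of the chain.
  have hex : ∃ k, LinearMap.ker (T ^ d) ≤ LinearMap.ker (T ^ k) := ⟨d, le_rfl⟩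
  have hle : ∀ k, LinearMap.ker (T ^ k) ≤ LinearMap.ker (T ^ d) :=
    fun k => Module.End.ker_pow_le_ker_pow_finrank T k
  obtain ⟨k, hk⟩ : ∃ k, Nat.find hex = k + 1 := by
    refine Nat.exists_eq_succ_of_ne_zero fun h0 => hT ?_
    have h := Nat.find_spec hex
    rw [h0, pow_zero] at h
    have h1 := (hle 1).trans h
    rw [pow_one] at h1
    exact eq_bot_iff.mpr (h1.trans (by rw [Module.End.one_eq_id, LinearMap.ker_id]))
  have hk1 := Nat.find_spec hex
  rw [hk] at hk1
  obtain ⟨x, hx, hx'⟩ := SetLike.not_le_iff_exists.mp (Nat.find_min hex (m := k) (by omega))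
  -- If `(T ^ k) x = (T ^ (k + 1)) y`, then `y` lies in the stationary kernel, so that `(T ^ k) x =
  -- 0`.
  have hnot : (T ^ k) x ∉ LinearMap.range (T ^ (k + 1)) := by
    rintro ⟨y, hy⟩
    have h2 : y ∈ LinearMap.ker (T ^ (k + 1 + 1)) := by
      rw [LinearMap.mem_ker, pow_succ', Module.End.mul_apply, hy, ← Module.End.mul_apply,
        ← pow_succ']
      exact hk1 hx
    have h3 := hk1 (hle _ h2)
    rw [LinearMap.mem_ker, hy] at h3
    exact hx' h3
  obtain ⟨f, hf, hker⟩ := Submodule.exists_le_ker_of_notMem hnot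
  exact ⟨k, x, f, hk1 hx, LinearMap.ext fun y => hker ⟨y, rfl⟩, hf⟩

theorem pow_apply_pow_apply {X : Type*} [AddCommGroup X] [Module ℂ X] (T : Module.End ℂ X)
    (i j : ℕ) (x : X) :
    (T ^ i) ((T ^ j) x) = (T ^ (i + j)) x := by
  rw [pow_add, Module.End.mul_apply]

/-- Jordan's theorem. A longest chain at an eigenvalue has an invariant complement, the common
kernel of the functionals `f ∘ₗ A ^ j`. -/
theorem HasForm.id_left {X : Type} [AddCommGroup X] [Module ℂ X] [FiniteDimensional ℂ X]
    (T : X →ₗ[ℂ] X) : HasForm LinearMap.id T := by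
  induction hd : Module.finrank ℂ X using Nat.strong_induction_on generalizing X with
  | _ d IH =>
  rcases subsingleton_or_nontrivial X with hX | hX
  · exact HasForm.of_subsingleton
  obtain ⟨μ, hμ⟩ := Module.End.exists_eigenvalue T
  set A : Module.End ℂ X := T - μ • 1 with hA
  have hTA : ∀ y, T y = A y + μ • y := fun y => by simp [hA]
  obtain ⟨k, x, f, hx, hf, hfx⟩ := exists_jordan_chain (T := A) (by
    obtain ⟨v, hv⟩ := hμ.exists_hasEigenvector
    intro h0
    have : v ∈ LinearMap.ker A := by
      simp [hA, hv.apply_eq_smul]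
    rw [h0] at this
    exact hv.2 (by simpa using this))
  have hx' : ∀ i, k + 1 ≤ i → (A ^ i) x = 0 := fun i hi => by
    obtain ⟨j, rfl⟩ := Nat.exists_eq_add_of_le' hi
    rw [← pow_apply_pow_apply, hx, map_zero]
  -- The exponents descend because `J` has its ones above the diagonal. The pairing `f ((A ^ (r + (k
  -- - l))) x)` vanishes for `l < r` and is `f ((A ^ k) x) ≠ 0` for `l = r`.
  have hp : Function.Injective
      (LinearMap.pi (fun j : Fin (k + 1) => f ∘ₗ A ^ (j : ℕ)) ∘ₗ
        Fintype.linearCombination ℂ (fun j : Fin (k + 1) => (A ^ (k - j)) x)) := by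
    refine injective_of_upper (fun r l hrl => ?_) fun r => ?_
    · rw [LinearMap.comp_apply, pow_apply_pow_apply, hx', map_zero]
      have : (l : ℕ) < r := hrl
      omega
    · rw [LinearMap.comp_apply, pow_apply_pow_apply]
      have : (r : ℕ) + (k - r) = k := by omega
      rwa [this]
  have hsplit : ∀ (r l : Fin (k + 1)) , J μ (k + 1) r l
      = μ * (if (l : ℕ) = r then 1 else 0) + if (l : ℕ) = r + 1 then 1 else 0 := by
    intro r l
    simp only [J, Matrix.of_apply]
    by_cases h1 : (l : ℕ) = r
    · obtain rfl := Fin.ext h1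
      simp
    · have h2 : r ≠ l := fun h => h1 (congrArg Fin.val h).symm
      simp [h1, h2, eq_comm]
  refine HasForm.of_split (HasForm.of_block (.jordan μ (k + 1)) k.succ_pos) _ _ _ _ (fun v => ?_)
    (linearCombination_mulVec fun (j : Fin (k + 1)) => ?_) (fun y => ?_) (fun y => ?_) hp hp
    fun hE hF => ?_
  · exact congrArg (Fintype.linearCombination ℂ _)
      (Matrix.one_mulVec (m := Fin (k + 1)) v).symm
  · change T ((A ^ (k - j)) x) = ∑ r : Fin (k + 1), J μ (k + 1) r j • (A ^ (k - r)) x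
    simp_rw [hsplit, add_smul, Finset.sum_add_distrib, mul_smul, ← Finset.smul_sum]
    simp_rw [eq_comm (a := (j : ℕ))]
    rw [sum_ite_val_eq_smul (k + 1) j fun r => (A ^ (k - r)) x, if_pos j.2, hTA, add_comm]
    congr 1
    rw [← Module.End.mul_apply, ← pow_succ']
    obtain ⟨j, hj⟩ := j
    cases j with
    | zero => simpa using hx
    | succ j =>
      simp only [add_left_inj]
      rw [sum_ite_val_eq_smul (k + 1) j fun r => (A ^ (k - r)) x, if_pos (by omega)]
      congr 2
      omega
  · exact (Matrix.one_mulVec (m := Fin (k + 1)) _).symm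
  · funext (r : Fin (k + 1))
    change f ((A ^ (r : ℕ)) (T y)) = ∑ j : Fin (k + 1), J μ (k + 1) r j • f ((A ^ (j : ℕ)) y)
    simp_rw [hsplit, add_smul, Finset.sum_add_distrib, mul_smul, ← Finset.smul_sum]
    rw [sum_ite_val_eq_smul (k + 1) r fun j => f ((A ^ j) y),
      sum_ite_val_eq_smul (k + 1) (r + 1) fun j => f ((A ^ j) y), if_pos r.2, hTA, map_add, map_add,
      map_smul, map_smul, add_comm]
    congr 1
    rw [← Module.End.mul_apply, ← pow_succ]
    split_ifs with hr
    · rfl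
    · have : (r : ℕ) + 1 = k + 1 := by omega
      rw [this]
      exact LinearMap.congr_fun hf y
  · have : LinearMap.id.restrict hE = LinearMap.id := rfl
    rw [this]
    refine IH _ ?_ _ rfl
    have := finrank_ker_add_of_injective_comp hp
    rw [Module.finrank_fintype_fun_eq_card, Fintype.card_fin, hd] at this
    exact lt_of_lt_of_eq (Nat.lt_add_of_pos_left k.succ_pos) this

/-- The same splitting at the eigenvalue 0, with the chain in the opposite order, since `N` has its
ones below the diagonal. -/
theorem HasForm.id_right {X : Type} [AddCommGroup X] [Module ℂ X] [FiniteDimensional ℂ X]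
    {T : Module.End ℂ X} (hT : IsNilpotent T) : HasForm T LinearMap.id := by
  induction hd : Module.finrank ℂ X using Nat.strong_induction_on generalizing X with
  | _ d IH =>
  rcases subsingleton_or_nontrivial X with hX | hX
  · exact HasForm.of_subsingleton
  obtain ⟨k, x, f, hx, hf, hfx⟩ := exists_jordan_chain (T := T) (by
    intro h0
    have hinj := LinearMap.ker_eq_bot.mp h0
    obtain ⟨n, hn⟩ := hT
    obtain ⟨v, hv⟩ := exists_ne (0 : X)
    have hinj' : Function.Injective (T ^ n) := by
      rw [Module.End.coe_pow]
      exact hinj.iterate n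
    apply hv
    apply hinj'
    rw [hn]
    simp)
  have hx' : ∀ i, k + 1 ≤ i → (T ^ i) x = 0 := fun i hi => by
    obtain ⟨j, rfl⟩ := Nat.exists_eq_add_of_le' hi
    rw [← pow_apply_pow_apply, hx, map_zero]
  have hp : Function.Injective
      (LinearMap.pi (fun j : Fin (k + 1) => f ∘ₗ T ^ (k - j)) ∘ₗ
        Fintype.linearCombination ℂ
          (fun j : Fin (k + 1) => (T ^ (j : ℕ)) x)) := by
    refine injective_of_lower (fun r l hrl => ?_) fun r => ?_
    · rw [LinearMap.comp_apply, pow_apply_pow_apply, hx', map_zero]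
      have : (r : ℕ) < l := hrl
      omega
    · rw [LinearMap.comp_apply, pow_apply_pow_apply]
      have : (k - r) + (r : ℕ) = k := by omega
      rwa [this]
  refine HasForm.of_split (HasForm.of_block (.infinite (k + 1)) k.succ_pos) _ _ _ _
    (linearCombination_mulVec fun (j : Fin (k + 1)) => ?_) (fun v => ?_) (fun y => ?_)
    (fun y => ?_) hp hp fun hE hF => ?_
  · change T ((T ^ (j : ℕ)) x) = ∑ r : Fin (k + 1), (if (j : ℕ) + 1 = r then (1 : ℂ) else 0) •
      (T ^ (r : ℕ)) x
    simp_rw [eq_comm (a := (j : ℕ) + 1)]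
    rw [sum_ite_val_eq_smul (k + 1) (j + 1) fun r => (T ^ r) x, ← Module.End.mul_apply, ← pow_succ']
    split_ifs with hj
    · rfl
    · exact hx' _ (by omega)
  · exact congrArg (Fintype.linearCombination ℂ _)
      (Matrix.one_mulVec (m := Fin (k + 1)) v).symm
  · funext (r : Fin (k + 1))
    change f ((T ^ (k - r)) (T y)) = ∑ j : Fin (k + 1), (if (j : ℕ) + 1 = r then (1 : ℂ) else 0) •
      f ((T ^ (k - j)) y)
    rw [← Module.End.mul_apply, ← pow_succ]
    obtain ⟨r, hr⟩ := r
    cases r with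
    | zero => simpa using LinearMap.congr_fun hf y
    | succ r =>
      simp only [add_left_inj]
      rw [sum_ite_val_eq_smul (k + 1) r fun j => f ((T ^ (k - j)) y), if_pos (by omega)]
      congr 3
      omega
  · exact (Matrix.one_mulVec (m := Fin (k + 1)) _).symm
  · have : LinearMap.id.restrict hF = LinearMap.id := rfl
    rw [this]
    refine IH _ ?_ (T := T.restrict hE) ?_ rfl
    · have := finrank_ker_add_of_injective_comp hp
      rw [Module.finrank_fintype_fun_eq_card, Fintype.card_fin, hd] at this
      exact lt_of_lt_of_eq (Nat.lt_add_of_pos_left k.succ_pos) this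
    · exact Module.End.isNilpotent.restrict hE hT

end Endomorphism

section Regular

variable {X Y : Type} [AddCommGroup X] [Module ℂ X] [FiniteDimensional ℂ X]
  [AddCommGroup Y] [Module ℂ Y]

theorem HasForm.of_bijective_left {E F : X →ₗ[ℂ] Y} (hE : Function.Bijective E) : HasForm E F := by
  let e := LinearEquiv.ofBijective E hE
  refine (HasForm.id_left (e.symm.toLinearMap ∘ₗ F)).of_equiv (LinearEquiv.refl ℂ X) e.symm
    (fun x => (e.symm_apply_apply x).symm) fun x => rfl

theorem HasForm.of_bijective_right {E F : X →ₗ[ℂ] Y} {N : Module.End ℂ X} (hN : IsNilpotent N)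
    (hF : Function.Bijective F) (h : ∀ x, F (N x) = E x) : HasForm E F := by
  let e := LinearEquiv.ofBijective F hF
  refine (HasForm.id_right hN).of_equiv (LinearEquiv.refl ℂ X) e.symm (fun x => ?_)
    fun x => (e.symm_apply_apply x).symm
  rw [LinearEquiv.eq_symm_apply]
  exact h x

theorem HasForm.of_isCompl {X : Type*} [AddCommGroup X] [Module ℂ X] {E F : X →ₗ[ℂ] X}
    {U W : Submodule ℂ X} (h : IsCompl U W)
    {hEU : ∀ x ∈ U, E x ∈ U} {hFU : ∀ x ∈ U, F x ∈ U} {hEW : ∀ x ∈ W, E x ∈ W}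
    {hFW : ∀ x ∈ W, F x ∈ W} (hU : HasForm (E.restrict hEU) (F.restrict hFU))
    (hW : HasForm (E.restrict hEW) (F.restrict hFW)) : HasForm E F := by
  let e := Submodule.prodEquivOfIsCompl U W h
  refine (hU.prodMap hW).of_equiv e.symm e.symm ?_ ?_
  · intro x
    obtain ⟨z, rfl⟩ := e.surjective x
    rw [LinearEquiv.eq_symm_apply, LinearEquiv.symm_apply_apply]
    simp [e]
  · intro x
    obtain ⟨z, rfl⟩ := e.surjective x
    rw [LinearEquiv.eq_symm_apply, LinearEquiv.symm_apply_apply]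
    simp [e]

/-- Fitting's decomposition: on the kernel of a high power `M` is nilpotent and `1 + c • M`
invertible, on its range `M` itself is invertible. -/
theorem HasForm.of_one_add_smul (M : Module.End ℂ X) (c : ℂ) : HasForm M (1 + c • M) := by
  -- `n ≥ 1` guarantees that the kernel of `M` lies in that of `M ^ n`.
  obtain ⟨n, hn, hn1⟩ := ((LinearMap.eventually_isCompl_ker_pow_range_pow M).and
    (Filter.eventually_ge_atTop 1)).exists
  have hcomm : ∀ x, (M ^ n) (M x) = M ((M ^ n) x) := fun x => by
    rw [← Module.End.mul_apply, ← Module.End.mul_apply, ← pow_succ, ← pow_succ']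
  have hMU : ∀ x ∈ LinearMap.ker (M ^ n), M x ∈ LinearMap.ker (M ^ n) := by
    intro x hx
    rw [LinearMap.mem_ker] at hx ⊢
    rw [hcomm, hx, map_zero]
  have hMW : ∀ x ∈ LinearMap.range (M ^ n), M x ∈ LinearMap.range (M ^ n) := by
    rintro _ ⟨x, rfl⟩
    exact ⟨M x, hcomm x⟩
  have hF : ∀ (U : Submodule ℂ X), (∀ x ∈ U, M x ∈ U) → ∀ x ∈ U, (1 + c • M) x ∈ U :=
    fun U hU x hx => U.add_mem hx (U.smul_mem c (hU x hx))
  refine HasForm.of_isCompl hn (hEU := hMU) (hEW := hMW) (hFU := hF _ hMU) (hFW := hF _ hMW) ?_ ?_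
  · set M0 : Module.End ℂ (LinearMap.ker (M ^ n)) := M.restrict hMU
    have hnil : IsNilpotent M0 := by
      refine ⟨n, LinearMap.ext fun x => Subtype.ext ?_⟩
      rw [Module.End.pow_restrict]
      exact x.2
    have hF0 : (1 + c • M).restrict (hF _ hMU) = 1 + c • M0 := rfl
    rw [hF0]
    have hunit : IsUnit (1 + c • M0) := (hnil.smul c).isUnit_one_add
    have hbij := (Module.End.isUnit_iff _).mp hunit
    set e := LinearEquiv.ofBijective (1 + c • M0) hbij
    -- Commuting factors are needed for the inverse of `1 + c • M0` times `M0` to be nilpotent.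
    have hcomm0 : Commute (e.symm.toLinearMap : Module.End ℂ _) M0 := by
      refine LinearMap.ext fun x => ?_
      change e.symm (M0 x) = M0 (e.symm x)
      rw [LinearEquiv.symm_apply_eq]
      obtain ⟨y, rfl⟩ := e.surjective x
      rw [e.symm_apply_apply]
      change M0 ((1 + c • M0) y) = (1 + c • M0) (M0 y)
      simp
    refine HasForm.of_bijective_right (hcomm0.isNilpotent_mul_left hnil) hbij fun x => ?_
    exact e.apply_symm_apply (M0 x)
  · refine HasForm.of_bijective_left ?_
    have hinj : Function.Injective (M.restrict hMW) := by
      rw [← LinearMap.ker_eq_bot, LinearMap.ker_eq_bot']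
      intro x hx
      have hx0 : M x = 0 := congrArg Subtype.val hx
      have : (x : X) ∈ LinearMap.ker (M ^ n) ⊓ LinearMap.range (M ^ n) := by
        refine ⟨?_, x.2⟩
        have hz : ∀ z : X, M z = 0 → (M ^ n) z = 0 := by
          intro z hz
          obtain ⟨j, rfl⟩ := Nat.exists_eq_add_of_le' hn1
          rw [pow_succ, Module.End.mul_apply, hz, map_zero]
        exact hz x hx0
      rw [hn.inf_eq_bot] at this
      exact Subtype.ext (by simpa using this)
    exact ⟨hinj, LinearMap.injective_iff_surjective.mp hinj⟩

/-- With M = (F - cE)⁻¹E one has (F - cE)⁻¹F = 1 + cM. -/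
theorem HasForm.of_regular {E F : X →ₗ[ℂ] Y} {c : ℂ} (h : Function.Bijective (F - c • E)) :
    HasForm E F := by
  let e := LinearEquiv.ofBijective _ h
  refine (HasForm.of_one_add_smul (e.symm.toLinearMap ∘ₗ E) c).of_equiv
    (LinearEquiv.refl ℂ X) e.symm
    (fun x => rfl) fun x => ?_
  rw [LinearEquiv.eq_symm_apply]
  change e (x + c • e.symm (E x)) = _
  rw [map_add, map_smul, e.apply_symm_apply]
  change F x - c • E x + c • E x = F x
  abel

end Regular

/-! ## Existence of the Kronecker canonical form -/

section Existence

open Polynomial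

/-- The matrix `s E - F` over the polynomial ring. -/
noncomputable def polyPencil {n m : ℕ} (E F : Matrix (Fin n) (Fin m) ℂ) :
    Matrix (Fin n) (Fin m) ℂ[X] := (X : ℂ[X]) • E.map C - F.map C

theorem polyPencil_transpose {n m : ℕ} (E F : Matrix (Fin n) (Fin m) ℂ) :
    polyPencil E.transpose F.transpose = (polyPencil E F).transpose := by
  ext i j
  simp [polyPencil]

theorem polyPencil_mulVec {n m : ℕ} (E F : Matrix (Fin n) (Fin m) ℂ) (v : Fin m → ℂ[X])
    (r : Fin n) : (polyPencil E F).mulVec v r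
      = X * ∑ j, C (E r j) * v j - ∑ j, C (F r j) * v j := by
  simp [polyPencil, Matrix.mulVec, dotProduct, sub_mul, Finset.mul_sum, mul_left_comm, mul_assoc]

variable {V W : Type} [AddCommGroup V] [Module ℂ V] [AddCommGroup W] [Module ℂ W]

/-- Comparing the coefficients of the powers of `X` in (XE - F)v = 0 gives the chain relations. -/
theorem exists_nullChain_of_mulVec_eq_zero {n m : ℕ} (bV : Module.Basis (Fin m) ℂ V)
    (bW : Module.Basis (Fin n) ℂ W) {E F : V →ₗ[ℂ] W} {v : Fin m → ℂ[X]}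
    (hv : (polyPencil (LinearMap.toMatrix bV bW E) (LinearMap.toMatrix bV bW F)).mulVec v = 0)
    (hv0 : v ≠ 0) : ∃ k x, IsNullChain E F k x ∧ x ≠ 0 := by
  let x : ℕ → V := fun i => ∑ j, (v j).coeff i • bV j
  have hrepr : ∀ (A : V →ₗ[ℂ] W) i r, bW.repr (A (x i)) r
      = (∑ j, C (LinearMap.toMatrix bV bW A r j) * v j).coeff i := by
    intro A i r
    simp [x, LinearMap.toMatrix_apply, Polynomial.finsetSum_coeff, mul_comm]
  have hv' : ∀ r, X * ∑ j, C (LinearMap.toMatrix bV bW E r j) * v j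
      = ∑ j, C (LinearMap.toMatrix bV bW F r j) * v j := fun r => by
    rw [← sub_eq_zero, ← polyPencil_mulVec, hv, Pi.zero_apply]
  refine ⟨Finset.univ.sup fun j => (v j).natDegree + 1, x, ⟨?_, fun i => ?_, fun i hi => ?_⟩, ?_⟩
  · refine bW.repr.injective (Finsupp.ext fun r => ?_)
    rw [hrepr, ← hv' r]
    simp
  · refine bW.repr.injective (Finsupp.ext fun r => ?_)
    rw [hrepr, hrepr, ← hv' r, coeff_X_mul]
  · refine Finset.sum_eq_zero fun j _ => ?_
    rw [coeff_eq_zero_of_natDegree_lt, zero_smul]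
    have := (Finset.le_sup (f := fun j => (v j).natDegree + 1) (Finset.mem_univ j)).trans hi
    exact this
  · intro hx
    apply hv0
    funext j
    ext i
    have h1 : bV.repr (x i) j = (v j).coeff i := by
      simp [x, Finsupp.single_apply]
    rw [← h1, hx]
    simp

/-- Injectivity on both sides over the polynomial ring forces a square matrix with nonzero
determinant, and any `c` that is not a root of the determinant will do. -/
theorem exists_bijective_of_injective {n m : ℕ} (bV : Module.Basis (Fin m) ℂ V)
    (bW : Module.Basis (Fin n) ℂ W) {E F : V →ₗ[ℂ] W}
    (h1 : ∀ v, (polyPencil (LinearMap.toMatrix bV bW E) (LinearMap.toMatrix bV bW F)).mulVec v = 0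
      → v = 0)
    (h2 : ∀ v, (polyPencil (LinearMap.toMatrix bV bW E)
      (LinearMap.toMatrix bV bW F)).transpose.mulVec v = 0 → v = 0) :
    ∃ c : ℂ, Function.Bijective (F - c • E) := by
  have hmn : m ≤ n := le_of_fin_injective ℂ[X] (Matrix.mulVecLin _)
    (LinearMap.ker_eq_bot.mp (LinearMap.ker_eq_bot'.mpr h1))
  have hnm : n ≤ m := le_of_fin_injective ℂ[X] (Matrix.mulVecLin _)
    (LinearMap.ker_eq_bot.mp (LinearMap.ker_eq_bot'.mpr h2))
  obtain rfl := le_antisymm hmn hnm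
  have hdet : (polyPencil (LinearMap.toMatrix bV bW E) (LinearMap.toMatrix bV bW F)).det ≠ 0 := by
    intro h0
    obtain ⟨v, hv, hv0⟩ := Matrix.exists_mulVec_eq_zero_iff.mpr h0
    exact hv (h1 v hv0)
  obtain ⟨c, hc⟩ : ∃ c, eval c
      (polyPencil (LinearMap.toMatrix bV bW E) (LinearMap.toMatrix bV bW F)).det ≠ 0 := by
    by_contra! hall
    exact hdet (Polynomial.funext fun c => by rw [hall, eval_zero])
  refine ⟨c, ?_⟩
  have hu : IsUnit (LinearMap.toMatrix bV bW (c • E - F)).det := by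
    rw [isUnit_iff_ne_zero]
    rw [← coe_evalRingHom, RingHom.map_det] at hc
    convert hc using 2
    ext i j
    simp [polyPencil]
    ring
  have hb : Function.Bijective (c • E - F) := (LinearEquiv.ofIsUnitDet hu).bijective
  have : ⇑(F - c • E) = ⇑(LinearEquiv.neg ℂ (M := W)) ∘ ⇑(c • E - F) := by
    funext x
    simp
  rw [this]
  exact (LinearEquiv.neg ℂ).bijective.comp hb

theorem hasForm [FiniteDimensional ℂ V] [FiniteDimensional ℂ W] (E F : V →ₗ[ℂ] W) :
    HasForm E F := by
  induction hd : Module.finrank ℂ V + Module.finrank ℂ W using Nat.strong_induction_on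
    generalizing V W with
  | _ d IH =>
  subst hd
  have IH' : SmallerHaveForm V W := fun V' W' _ _ _ _ _ _ E' F' h => IH _ h E' F' rfl
  by_cases h1 : ∃ k x, IsNullChain E F k x ∧ x ≠ 0
  · exact HasForm.of_nullChain IH' h1
  by_cases h2 : ∃ k x, IsNullChain E.dualMap F.dualMap k x ∧ x ≠ 0
  · exact HasForm.of_dual_nullChain IH' h2
  let bV := Module.finBasis ℂ V
  let bW := Module.finBasis ℂ W
  obtain ⟨c, hc⟩ := exists_bijective_of_injective bV bW (E := E) (F := F)
    (fun v hv => by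
      by_contra hv0
      exact h1 (exists_nullChain_of_mulVec_eq_zero bV bW hv hv0))
    (fun v hv => by
      by_contra hv0
      -- In the dual bases the dual pencil has the transposed matrix, so left null vectors are null
      -- vectors of the dual pencil.
      refine h2 (exists_nullChain_of_mulVec_eq_zero bW.dualBasis bV.dualBasis (v := v) ?_ hv0)
      rw [← polyPencil_transpose] at hv
      rw [← hv, ← LinearMap.toMatrix_transpose, ← LinearMap.toMatrix_transpose]
      rfl)
  exact HasForm.of_regular hc

end Existence

theorem exists_isFormOf {n m : ℕ} (E F : Matrix (Fin n) (Fin m) ℂ) :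
    ∃ D : Data, D.IsFormOf E F :=
  let ⟨D, hD⟩ := hasForm E.mulVecLin F.mulVecLin
  ⟨D, D.isFormOf_of_formedBy hD⟩

end Kronecker

namespace LinRel

/-! ## Direct sums of linear relations -/

section Membership

variable {V : Type*} [AddCommGroup V] [Module ℂ V] {S T : LinRel V}

theorem mem_dom {x : V} : x ∈ dom S ↔ ∃ y, (x, y) ∈ S := by
  simp [dom]

theorem mem_ran {y : V} : y ∈ ran S ↔ ∃ x, (x, y) ∈ S := by
  simp [ran]

theorem mem_ker {x : V} : x ∈ ker S ↔ (x, 0) ∈ S := Iff.rfl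

theorem mem_mul {y : V} : y ∈ mul S ↔ (0, y) ∈ S := Iff.rfl

theorem mem_sub {μ : ℂ} {x y : V} : (x, y) ∈ sub S μ ↔ (x, y + μ • x) ∈ S := by
  constructor
  · rintro ⟨⟨a, b⟩, h, hab⟩
    obtain ⟨rfl, rfl⟩ := Prod.mk.inj hab
    simpa using h
  · intro h
    exact ⟨(x, y + μ • x), h, by simp⟩

theorem mem_pow_zero {x y : V} : (x, y) ∈ pow S 0 ↔ x = y := Iff.rfl

theorem mem_pow_succ {k : ℕ} {x z : V} :
    (x, z) ∈ pow S (k + 1) ↔ ∃ y, (x, y) ∈ pow S k ∧ (y, z) ∈ S :=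
  ⟨fun ⟨y, h1, h2⟩ => ⟨y, h2, h1⟩, fun ⟨y, h1, h2⟩ => ⟨y, h2, h1⟩⟩

/-- Powers are built by composition on the left, whereas kernels of powers are computed by peeling
off the factor on the right. -/
theorem mem_pow_succ' {k : ℕ} {x z : V} :
    (x, z) ∈ pow S (k + 1) ↔ ∃ y, (x, y) ∈ S ∧ (y, z) ∈ pow S k := by
  induction k generalizing z with
  | zero => simp [mem_pow_succ, mem_pow_zero]
  | succ k ih =>
    rw [mem_pow_succ]
    simp only [ih]
    constructor
    · rintro ⟨y, ⟨w, h1, h2⟩, h3⟩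
      exact ⟨w, h1, mem_pow_succ.mpr ⟨y, h2, h3⟩⟩
    · rintro ⟨w, h1, h2⟩
      obtain ⟨y, h3, h4⟩ := mem_pow_succ.mp h2
      exact ⟨y, ⟨w, h1, h3⟩, h4⟩

theorem mem_ker_pow_succ {k : ℕ} {x : V} :
    x ∈ ker (pow S (k + 1)) ↔ ∃ y ∈ ker (pow S k), (x, y) ∈ S := by
  rw [mem_ker, mem_pow_succ']
  exact ⟨fun ⟨y, h1, h2⟩ => ⟨y, h2, h1⟩, fun ⟨y, h1, h2⟩ => ⟨y, h2, h1⟩⟩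

theorem mem_mul_pow_succ {k : ℕ} {y : V} :
    y ∈ mul (pow S (k + 1)) ↔ ∃ x ∈ mul (pow S k), (x, y) ∈ S := mem_pow_succ

theorem mem_ran_pow_succ {k : ℕ} {y : V} :
    y ∈ ran (pow S (k + 1)) ↔ ∃ x ∈ ran (pow S k), (x, y) ∈ S := by
  simp only [mem_ran, mem_pow_succ]
  exact ⟨fun ⟨x, z, h1, h2⟩ => ⟨z, ⟨x, h1⟩, h2⟩, fun ⟨z, ⟨x, h1⟩, h2⟩ => ⟨x, z, h1, h2⟩⟩

theorem ker_pow_zero : ker (pow S 0) = ⊥ := by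
  ext x
  rw [mem_ker, mem_pow_zero, Submodule.mem_bot]

theorem mul_pow_zero : mul (pow S 0) = ⊥ := by
  ext x
  rw [mem_mul, mem_pow_zero, Submodule.mem_bot, eq_comm]

theorem ran_pow_zero : ran (pow S 0) = ⊤ := by
  ext x
  simp [mem_ran, mem_pow_zero]

theorem ran_pow_one : ran (pow S 1) = ran S := by
  ext x
  rw [mem_ran_pow_succ, ran_pow_zero]
  simp [mem_ran]

theorem ker_pow_eq_bot (h : ker S = ⊥) (k : ℕ) : ker (pow S k) = ⊥ := by
  induction k with
  | zero => exact ker_pow_zero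
  | succ k ih =>
    rw [eq_bot_iff]
    intro x hx
    obtain ⟨y, hy, hxy⟩ := mem_ker_pow_succ.mp hx
    rw [ih, Submodule.mem_bot] at hy
    subst hy
    rw [← h]
    exact hxy

theorem mul_pow_eq_bot (h : mul S = ⊥) (k : ℕ) : mul (pow S k) = ⊥ := by
  induction k with
  | zero => exact mul_pow_zero
  | succ k ih =>
    rw [eq_bot_iff]
    intro x hx
    obtain ⟨y, hy, hxy⟩ := mem_mul_pow_succ.mp hx
    rw [ih, Submodule.mem_bot] at hy
    subst hy
    rw [← h]
    exact hxy

theorem ran_pow_eq_top (h : ran S = ⊤) (k : ℕ) : ran (pow S k) = ⊤ := by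
  induction k with
  | zero => exact ran_pow_zero
  | succ k ih =>
    rw [eq_top_iff]
    intro y _
    have hy : y ∈ ran S := h ▸ Submodule.mem_top
    obtain ⟨x, hx⟩ := mem_ran.mp hy
    exact mem_ran_pow_succ.mpr ⟨x, ih ▸ Submodule.mem_top, hx⟩

theorem rootZero_eq_bot (h : ker S = ⊥) : rootZero S = ⊥ := by
  simp [rootZero, ker_pow_eq_bot h]

theorem rootInfty_eq_bot (h : mul S = ⊥) : rootInfty S = ⊥ := by
  simp [rootInfty, mul_pow_eq_bot h]

theorem rootZero_eq_top {k : ℕ} (h : ker (pow S k) = ⊤) : rootZero S = ⊤ :=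
  top_unique (h.symm.le.trans (le_iSup (fun k => ker (pow S k)) k))

theorem rootInfty_eq_top {k : ℕ} (h : mul (pow S k) = ⊤) : rootInfty S = ⊤ :=
  top_unique (h.symm.le.trans (le_iSup (fun k => mul (pow S k)) k))

end Membership

section QuotDim

variable {V : Type*} [AddCommGroup V] [Module ℂ V]

theorem quotDim_self (A : Submodule ℂ V) : quotDim A A = 0 := by
  rw [quotDim, Submodule.submoduleOf_self]
  exact Module.finrank_zero_of_subsingleton

theorem quotDim_eq_one {A B : Submodule ℂ V} (f : V →ₗ[ℂ] ℂ) (h : ∀ x ∈ A, f x = 0 ↔ x ∈ B)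
    (h1 : ∃ x ∈ A, f x ≠ 0) : quotDim A B = 1 := by
  have hker : LinearMap.ker (f ∘ₗ A.subtype) = B.submoduleOf A := by
    ext x
    exact h x x.2
  have hsurj : Function.Surjective (f ∘ₗ A.subtype) := by
    apply LinearMap.surjective_of_ne_zero
    obtain ⟨x, hx, hfx⟩ := h1
    intro h0
    exact hfx (LinearMap.congr_fun h0 ⟨x, hx⟩)
  rw [quotDim, ← hker, (LinearMap.quotKerEquivOfSurjective _ hsurj).finrank_eq,
    Module.finrank_self]

end QuotDim

section DirectSum

variable {ι V : Type*} {W : ι → Type*} [AddCommGroup V] [Module ℂ V]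
  [∀ i, AddCommGroup (W i)] [∀ i, Module ℂ (W i)]

/-- `S` is the direct sum of the relations `Si`. -/
def IsDirectSum (e : V ≃ₗ[ℂ] ((i : ι) → W i)) (S : LinRel V) (Si : (i : ι) → LinRel (W i)) :
    Prop := ∀ x y, (x, y) ∈ S ↔ ∀ i, (e x i, e y i) ∈ Si i

/-- `A` is the direct sum of the subspaces `Ai`. -/
def IsPi (e : V ≃ₗ[ℂ] ((i : ι) → W i)) (A : Submodule ℂ V) (Ai : (i : ι) → Submodule ℂ (W i)) :
    Prop := ∀ x, x ∈ A ↔ ∀ i, e x i ∈ Ai i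

variable {e : V ≃ₗ[ℂ] ((i : ι) → W i)} {S : LinRel V} {Si : (i : ι) → LinRel (W i)}
  {A B : Submodule ℂ V} {Ai Bi : (i : ι) → Submodule ℂ (W i)}

namespace IsPi

theorem inf (hA : IsPi e A Ai) (hB : IsPi e B Bi) : IsPi e (A ⊓ B) fun i => Ai i ⊓ Bi i := by
  intro x
  simp only [Submodule.mem_inf, hA x, hB x, forall_and]

theorem sup (hA : IsPi e A Ai) (hB : IsPi e B Bi) : IsPi e (A ⊔ B) fun i => Ai i ⊔ Bi i := by
  intro x
  simp only [Submodule.mem_sup]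
  constructor
  · rintro ⟨a, ha, b, hb, rfl⟩ i
    exact ⟨e a i, (hA a).mp ha i, e b i, (hB b).mp hb i, by simp⟩
  · intro h
    choose a ha b hb hab using h
    refine ⟨e.symm a, (hA _).mpr (by simpa using ha), e.symm b, (hB _).mpr (by simpa using hb), ?_⟩
    rw [← map_add, LinearEquiv.symm_apply_eq]
    exact funext hab

theorem iSup [Finite ι] {A : ℕ → Submodule ℂ V} {Ai : ℕ → (i : ι) → Submodule ℂ (W i)}
    (hA : ∀ k, IsPi e (A k) (Ai k)) (hm : Monotone A) (hmi : ∀ i, Monotone fun k => Ai k i) :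
    IsPi e (⨆ k, A k) fun i => ⨆ k, Ai k i := by
  have := Fintype.ofFinite ι
  intro x
  rw [Submodule.mem_iSup_of_directed _ hm.directed_le]
  constructor
  · rintro ⟨k, hk⟩ i
    exact (le_iSup (fun k => Ai k i) k) ((hA k x).mp hk i)
  · intro h
    have h' : ∀ i, ∃ k, e x i ∈ Ai k i := fun i =>
      (Submodule.mem_iSup_of_directed _ (hmi i).directed_le).mp (h i)
    choose k hk using h'
    -- Finitely many components share a common exponent, the largest one.
    exact ⟨Finset.univ.sup k, (hA _ x).mpr fun i =>
      hmi i (Finset.le_sup (Finset.mem_univ i)) (hk i)⟩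

/-- The componentwise map from `A` to the product of the quotients is onto, with kernel `B`. -/
theorem quotDim_eq_sum [Fintype ι] [∀ i, FiniteDimensional ℂ (W i)] (hA : IsPi e A Ai)
    (hB : IsPi e B Bi) : quotDim A B = ∑ i, quotDim (Ai i) (Bi i) := by
  let f : A →ₗ[ℂ] ((i : ι) → (Ai i) ⧸ (Bi i).submoduleOf (Ai i)) :=
    LinearMap.pi fun i => (Submodule.mkQ _) ∘ₗ
      (((LinearMap.proj i ∘ₗ e.toLinearMap) ∘ₗ A.subtype).codRestrict (Ai i)
        fun x => (hA x).mp x.2 i)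
  have hf : ∀ x i, f x i = Submodule.Quotient.mk ⟨e x i, (hA x).mp x.2 i⟩ := fun x i => rfl
  have hker : LinearMap.ker f = B.submoduleOf A := by
    ext x
    rw [LinearMap.mem_ker, funext_iff]
    simp only [hf, Pi.zero_apply, Submodule.Quotient.mk_eq_zero]
    exact (hB x).symm
  have hsurj : Function.Surjective f := by
    intro y
    choose z hz using fun i => Submodule.Quotient.mk_surjective _ (y i)
    refine ⟨⟨e.symm fun i => z i, (hA _).mpr fun i => by simp⟩, ?_⟩
    funext i
    rw [hf, ← hz i]
    simp
  rw [quotDim, ← hker, (LinearMap.quotKerEquivOfSurjective _ hsurj).finrank_eq,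
    Module.finrank_pi_fintype]
  rfl

end IsPi

namespace IsDirectSum

theorem ker (h : IsDirectSum e S Si) : IsPi e (ker S) fun i => LinRel.ker (Si i) := by
  intro x
  simp [mem_ker, h x 0]

theorem mul (h : IsDirectSum e S Si) : IsPi e (mul S) fun i => LinRel.mul (Si i) := by
  intro x
  simp [mem_mul, h 0 x]

theorem dom (h : IsDirectSum e S Si) : IsPi e (dom S) fun i => LinRel.dom (Si i) := by
  intro x
  simp only [mem_dom]
  constructor
  · rintro ⟨y, hy⟩ i
    exact ⟨e y i, (h x y).mp hy i⟩
  · intro hx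
    choose y hy using hx
    exact ⟨e.symm y, (h _ _).mpr (by simpa using hy)⟩

theorem ran (h : IsDirectSum e S Si) : IsPi e (ran S) fun i => LinRel.ran (Si i) := by
  intro x
  simp only [mem_ran]
  constructor
  · rintro ⟨y, hy⟩ i
    exact ⟨e y i, (h y x).mp hy i⟩
  · intro hx
    choose y hy using hx
    exact ⟨e.symm y, (h _ _).mpr (by simpa using hy)⟩

theorem sub (h : IsDirectSum e S Si) (μ : ℂ) :
    IsDirectSum e (sub S μ) fun i => LinRel.sub (Si i) μ := by
  intro x y
  simp [mem_sub, h _ _]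

theorem pow (h : IsDirectSum e S Si) (k : ℕ) :
    IsDirectSum e (pow S k) fun i => LinRel.pow (Si i) k := by
  induction k with
  | zero =>
    intro x y
    simp only [mem_pow_zero]
    rw [← funext_iff, e.injective.eq_iff]
  | succ k ih =>
    intro x z
    simp only [mem_pow_succ]
    constructor
    · rintro ⟨y, h1, h2⟩ i
      exact ⟨e y i, (ih x y).mp h1 i, (h y z).mp h2 i⟩
    · intro hi
      choose y h1 h2 using hi
      exact ⟨e.symm y, (ih _ _).mpr (by simpa using h1), (h _ _).mpr (by simpa using h2)⟩

theorem rootZero [Finite ι] (h : IsDirectSum e S Si) :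
    IsPi e (rootZero S) fun i => LinRel.rootZero (Si i) :=
  IsPi.iSup (fun k => (h.pow k).ker) (ker_pow_mono S) fun i => ker_pow_mono (Si i)

theorem rootInfty [Finite ι] (h : IsDirectSum e S Si) :
    IsPi e (rootInfty S) fun i => LinRel.rootInfty (Si i) :=
  IsPi.iSup (fun k => (h.pow k).mul) (mul_pow_mono S) fun i => mul_pow_mono (Si i)

theorem singChains [Finite ι] (h : IsDirectSum e S Si) :
    IsPi e (singChains S) fun i => LinRel.singChains (Si i) := h.rootZero.inf h.rootInfty

variable [Fintype ι] [∀ i, FiniteDimensional ℂ (W i)]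

theorem weyrW (h : IsDirectSum e S Si) (μ : ℂ) (k : ℕ) :
    weyrW S μ k = ∑ i, LinRel.weyrW (Si i) μ k :=
  (((h.sub μ).pow (k + 1)).ker.sup h.singChains).quotDim_eq_sum
    (((h.sub μ).pow k).ker.sup h.singChains)

theorem weyrA (h : IsDirectSum e S Si) (k : ℕ) : weyrA S k = ∑ i, LinRel.weyrA (Si i) k :=
  ((h.pow (k + 1)).mul.sup h.singChains).quotDim_eq_sum ((h.pow k).mul.sup h.singChains)

theorem weyrB (h : IsDirectSum e S Si) (k : ℕ) : weyrB S k = ∑ i, LinRel.weyrB (Si i) k :=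
  ((h.pow (k + 1)).ker.inf h.singChains).quotDim_eq_sum ((h.pow k).ker.inf h.singChains)

theorem weyrC (h : IsDirectSum e S Si) (k : ℕ) : weyrC S k = ∑ i, LinRel.weyrC (Si i) k := by
  cases k with
  | zero => exact (h.ran.sup h.dom).quotDim_eq_sum (h.ran.sup h.rootZero)
  | succ k =>
    exact ((h.pow (k + 2)).ran.sup h.rootZero).quotDim_eq_sum ((h.pow (k + 3)).ran.sup h.rootZero)

end IsDirectSum

end DirectSum

end LinRel

namespace LinRel

/-! ## Vanishing of the Weyr sequences -/

section Vanishing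

variable {V : Type*} [AddCommGroup V] [Module ℂ V] {S : LinRel V}

theorem quotDim_top (A : Submodule ℂ V) : quotDim A ⊤ = 0 := by
  have : (⊤ : Submodule ℂ V).submoduleOf A = ⊤ := by
    ext x
    simp [Submodule.submoduleOf]
  rw [quotDim, this]
  exact Module.finrank_zero_of_subsingleton

theorem sub_zero_eq (S : LinRel V) : sub S 0 = S := by
  ext ⟨x, y⟩
  simp [mem_sub]

theorem singChains_eq_bot (h : mul S = ⊥) : singChains S = ⊥ := by
  rw [singChains, rootInfty_eq_bot h, inf_bot_eq]

theorem weyrW_eq_zero_of_ker {μ : ℂ} (h : ker (sub S μ) = ⊥) (k : ℕ) : weyrW S μ k = 0 := by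
  rw [weyrW, ker_pow_eq_bot h, ker_pow_eq_bot h, quotDim_self]

theorem weyrW_eq_zero_of_singChains (h : singChains S = ⊤) (μ : ℂ) (k : ℕ) : weyrW S μ k = 0 := by
  rw [weyrW, h, sup_top_eq, sup_top_eq, quotDim_top]

theorem weyrA_eq_zero_of_mul (h : mul S = ⊥) (k : ℕ) : weyrA S k = 0 := by
  rw [weyrA, mul_pow_eq_bot h, mul_pow_eq_bot h, quotDim_self]

theorem weyrA_eq_zero_of_singChains (h : singChains S = ⊤) (k : ℕ) : weyrA S k = 0 := by
  rw [weyrA, h, sup_top_eq, sup_top_eq, quotDim_top]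

theorem weyrB_eq_zero_of_singChains (h : singChains S = ⊥) (k : ℕ) : weyrB S k = 0 := by
  rw [weyrB, h, inf_bot_eq, inf_bot_eq, quotDim_self]

theorem weyrC_eq_zero_of_ran (h : ran S = ⊤) (k : ℕ) : weyrC S k = 0 := by
  cases k with
  | zero => simp only [weyrC, h, top_sup_eq, quotDim_top]
  | succ k => simp only [weyrC, ran_pow_eq_top h, top_sup_eq, quotDim_top]

theorem weyrC_eq_zero_of_rootZero (h : rootZero S = ⊤) (k : ℕ) : weyrC S k = 0 := by
  cases k <;> simp only [weyrC, h, sup_top_eq, quotDim_top]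

end Vanishing

/-! ## Coordinate subspaces -/

section Coordinates

/-- The extension of a vector by zeros. -/
def zeroExt {k : ℕ} (x : Fin k → ℂ) (j : ℕ) : ℂ := if h : j < k then x ⟨j, h⟩ else 0

variable {k : ℕ}

@[simp]
theorem zeroExt_val (x : Fin k → ℂ) (j : Fin k) : zeroExt x j = x j := by
  simp [zeroExt]

theorem zeroExt_of_le (x : Fin k → ℂ) {j : ℕ} (h : k ≤ j) : zeroExt x j = 0 := by
  simp [zeroExt, h]

theorem zeroExt_mk (f : ℕ → ℂ) {j : ℕ} (h : j < k) : zeroExt (fun i : Fin k => f i) j = f j := by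
  simp [zeroExt, h]

@[simp]
theorem zeroExt_zero (j : ℕ) : zeroExt (0 : Fin k → ℂ) j = 0 := by
  simp [zeroExt]

theorem zeroExt_smul (c : ℂ) (x : Fin k → ℂ) (j : ℕ) : zeroExt (c • x) j = c * zeroExt x j := by
  simp only [zeroExt]
  split_ifs <;> simp

theorem eq_zero_of_zeroExt {x : Fin k → ℂ} (h : ∀ j < k, zeroExt x j = 0) : x = 0 := by
  funext j
  rw [← zeroExt_val x j]
  exact h j j.2

theorem sum_ite_mul (x : Fin k → ℂ) (a : ℕ) :
    ∑ j : Fin k, (if (j : ℕ) = a then (1 : ℂ) else 0) * x j = zeroExt x a := by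
  have := Kronecker.sum_ite_val_eq_smul k a (zeroExt x)
  simp only [zeroExt_val, smul_eq_mul] at this
  rw [this]
  split_ifs with h
  · rfl
  · rw [zeroExt_of_le x (by omega)]

/-- `P` and `Q` mark the coordinates that must vanish; `Q` marks just `r₀` in addition, so the unit
vector at `r₀` spans the quotient. -/
theorem quotDim_eq_one_of_coord {A B : Submodule ℂ (Fin k → ℂ)} {P Q : ℕ → Prop}
    (hA : ∀ x, x ∈ A ↔ ∀ r < k, P r → zeroExt x r = 0)
    (hB : ∀ x, x ∈ B ↔ ∀ r < k, Q r → zeroExt x r = 0) {r₀ : ℕ} (hr₀ : r₀ < k) (hP : ¬ P r₀)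
    (hQ : ∀ r < k, Q r ↔ P r ∨ r = r₀) : quotDim A B = 1 := by
  refine quotDim_eq_one (LinearMap.proj ⟨r₀, hr₀⟩) (fun x hx => ?_) ⟨Pi.single ⟨r₀, hr₀⟩ 1, ?_, ?_⟩
  · have h0 : (LinearMap.proj ⟨r₀, hr₀⟩ : (Fin k → ℂ) →ₗ[ℂ] ℂ) x = zeroExt x r₀ := by
      simp [zeroExt, hr₀]
    rw [h0, hB]
    constructor
    · intro h r hr hQr
      rcases (hQ r hr).mp hQr with h' | rfl
      · exact (hA x).mp hx r hr h'
      · exact h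
    · intro h
      exact h r₀ hr₀ ((hQ r₀ hr₀).mpr (.inr rfl))
  · rw [hA]
    intro r hr hPr
    have : r ≠ r₀ := by
      rintro rfl
      exact hP hPr
    simp [zeroExt, hr, this]
  · simp

theorem quotDim_eq_zero_of_coord {A B : Submodule ℂ (Fin k → ℂ)} {P Q : ℕ → Prop}
    (hA : ∀ x, x ∈ A ↔ ∀ r < k, P r → zeroExt x r = 0)
    (hB : ∀ x, x ∈ B ↔ ∀ r < k, Q r → zeroExt x r = 0)
    (hQ : ∀ r < k, Q r ↔ P r) : quotDim A B = 0 := by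
  have : A = B := by
    ext x
    rw [hA, hB]
    exact forall₂_congr fun r hr => by rw [hQ r hr]
  rw [this, quotDim_self]

variable {T : LinRel (Fin k → ℂ)}

/-- Each step of the relation moves the coordinates down by one place. Serves both Jordan blocks,
after subtracting the eigenvalue, and column blocks, where the last coordinate of `y` is free and is
chosen to be 0. -/
theorem mem_ker_pow_of_shift
    (h1 : ∀ x y, (x, y) ∈ T → ∀ r, r + 1 < k → zeroExt x (r + 1) = zeroExt y r)
    (h2 : ∀ x : Fin k → ℂ, (x, fun r : Fin k => zeroExt x (r + 1)) ∈ T) (n : ℕ) (x : Fin k → ℂ) :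
    x ∈ ker (pow T n) ↔ ∀ r < k, n ≤ r → zeroExt x r = 0 := by
  induction n generalizing x with
  | zero =>
    rw [ker_pow_zero, Submodule.mem_bot]
    exact ⟨by rintro rfl; simp, fun h => eq_zero_of_zeroExt fun j hj => h j hj (Nat.zero_le j)⟩
  | succ n ih =>
    rw [mem_ker_pow_succ]
    constructor
    · rintro ⟨y, hy, hxy⟩ r hr hn
      obtain ⟨r, rfl⟩ : ∃ s, r = s + 1 := ⟨r - 1, by omega⟩
      rw [h1 x y hxy r hr]
      exact (ih y).mp hy r (by omega) (by omega)
    · intro h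
      refine ⟨_, (ih _).mpr fun r hr hn => ?_, h2 x⟩
      rw [zeroExt_mk (fun r => zeroExt x (r + 1)) hr]
      by_cases hrk : r + 1 < k
      · exact h _ hrk (by omega)
      · exact zeroExt_of_le x (by omega)

/-- Starting from 0, only a free last coordinate can enter, and each step moves it down by one
place: `n` steps reach the last `n` coordinates. Serves blocks at infinity and column blocks. -/
theorem mem_mul_pow_of_shift
    (h1 : ∀ x y, (x, y) ∈ T → ∀ r, r + 1 < k → zeroExt x (r + 1) = zeroExt y r)
    (h2 : ∀ y : Fin k → ℂ,
      ((fun r : Fin k => if (r : ℕ) = 0 then 0 else zeroExt y (r - 1)), y) ∈ T)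
    (n : ℕ) (y : Fin k → ℂ) :
    y ∈ mul (pow T n) ↔ ∀ r < k, r + n < k → zeroExt y r = 0 := by
  induction n generalizing y with
  | zero =>
    rw [mul_pow_zero, Submodule.mem_bot]
    exact ⟨by rintro rfl; simp, fun h => eq_zero_of_zeroExt fun j hj => h j hj hj⟩
  | succ n ih =>
    rw [mem_mul_pow_succ]
    constructor
    · rintro ⟨x, hx, hxy⟩ r hr hn
      rw [← h1 x y hxy r (by omega)]
      exact (ih x).mp hx _ (by omega) (by omega)
    · intro h
      refine ⟨_, (ih _).mpr fun r hr hn => ?_, h2 y⟩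
      rw [zeroExt_mk (fun r => if r = 0 then 0 else zeroExt y (r - 1)) hr]
      split_ifs with h0
      · rfl
      · exact h _ (by omega) (by omega)

theorem ran_eq_top_of_shift
    (h2 : ∀ y : Fin k → ℂ,
      ((fun r : Fin k => if (r : ℕ) = 0 then 0 else zeroExt y (r - 1)), y) ∈ T) : ran T = ⊤ :=
  eq_top_iff.mpr fun y _ => mem_ran.mpr ⟨_, h2 y⟩

theorem quotDim_tail {A B : Submodule ℂ (Fin k → ℂ)} {n : ℕ}
    (hA : ∀ x, x ∈ A ↔ ∀ r < k, n + 1 ≤ r → zeroExt x r = 0)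
    (hB : ∀ x, x ∈ B ↔ ∀ r < k, n ≤ r → zeroExt x r = 0) :
    quotDim A B = if n + 1 ≤ k then 1 else 0 := by
  split_ifs with h
  · exact quotDim_eq_one_of_coord hA hB (r₀ := n) (by omega) (by omega) fun r hr => by omega
  · exact quotDim_eq_zero_of_coord hA hB fun r hr => by omega

end Coordinates

end LinRel

namespace Kronecker

open LinRel

/-! ## The Weyr characteristic of a block -/

theorem mem_kernelRep {n m : ℕ} {E F : Matrix (Fin n) (Fin m) ℂ} {x y : Fin m → ℂ} :
    (x, y) ∈ kernelRep E F ↔ ∀ r, F.mulVec x r = E.mulVec y r := by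
  rw [← funext_iff]
  rfl

theorem J_mulVec {μ : ℂ} {k : ℕ} (x : Fin k → ℂ) (r : Fin k) :
    (J μ k).mulVec x r = μ * x r + zeroExt x (r + 1) := by
  have h : ∀ l : Fin k, J μ k r l * x l
      = (if (l : ℕ) = r then (1 : ℂ) else 0) * (μ * x l) +
        (if (l : ℕ) = r + 1 then (1 : ℂ) else 0) * x l := by
    intro l
    simp only [J, Matrix.of_apply]
    by_cases h1 : (l : ℕ) = r
    · obtain rfl := Fin.ext h1
      simp
    · have h2 : r ≠ l := fun h => h1 (congrArg Fin.val h).symm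
      simp [h1, h2, eq_comm]
  simp only [Matrix.mulVec, dotProduct, h, Finset.sum_add_distrib, sum_ite_mul]
  rw [zeroExt_val]

theorem N_mulVec {k : ℕ} (x : Fin k → ℂ) (r : Fin k) :
    (N k).mulVec x r = if (r : ℕ) = 0 then 0 else zeroExt x (r - 1) := by
  simp only [Matrix.mulVec, dotProduct, N, Matrix.of_apply]
  split_ifs with h
  · exact Finset.sum_eq_zero fun l _ => by rw [if_neg (by omega), zero_mul]
  · rw [← sum_ite_mul]
    refine Finset.sum_congr rfl fun l _ => ?_
    congr 2
    exact propext (by omega)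

theorem K_mulVec {k : ℕ} (x : Fin k → ℂ) (r : Fin (k - 1)) :
    (K k).mulVec x r = zeroExt x r :=
  sum_ite_mul x r

theorem L_mulVec {k : ℕ} (x : Fin k → ℂ) (r : Fin (k - 1)) :
    (L k).mulVec x r = zeroExt x (r + 1) :=
  sum_ite_mul x (r + 1)

theorem K_transpose_mulVec {k : ℕ} (x : Fin (k - 1) → ℂ) (r : Fin k) :
    (K k).transpose.mulVec x r = zeroExt x r := by
  simp only [Matrix.mulVec, dotProduct, K, Matrix.transpose_apply, Matrix.of_apply]
  rw [← sum_ite_mul]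
  refine Finset.sum_congr rfl fun l _ => ?_
  congr 2
  exact propext (by omega)

theorem L_transpose_mulVec {k : ℕ} (x : Fin (k - 1) → ℂ) (r : Fin k) :
    (L k).transpose.mulVec x r = if (r : ℕ) = 0 then 0 else zeroExt x (r - 1) := by
  simp only [Matrix.mulVec, dotProduct, L, Matrix.transpose_apply, Matrix.of_apply]
  split_ifs with h
  · exact Finset.sum_eq_zero fun l _ => by rw [if_neg (by omega), zero_mul]
  · rw [← sum_ite_mul]
    refine Finset.sum_congr rfl fun l _ => ?_
    congr 2
    exact propext (by omega)

section Jordan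

variable {lam : ℂ} {k : ℕ}

theorem mem_jordan {x y : Fin k → ℂ} : (x, y) ∈ kernelRep 1 (J lam k) ↔
    ∀ r : Fin k, lam * x r + zeroExt x (r + 1) = y r := by
  simp [mem_kernelRep, J_mulVec]

theorem mul_jordan : mul (kernelRep 1 (J lam k)) = ⊥ := by
  refine eq_bot_iff.mpr fun y hy => ?_
  rw [mem_mul, mem_jordan] at hy
  rw [Submodule.mem_bot]
  funext r
  simpa using (hy r).symm

theorem mem_ker_pow_jordan (n : ℕ) (x : Fin k → ℂ) :
    x ∈ ker (pow (sub (kernelRep 1 (J lam k)) lam) n) ↔ ∀ r < k, n ≤ r → zeroExt x r = 0 := by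
  refine mem_ker_pow_of_shift (fun x y h r hr => ?_) (fun x => ?_) n x
  · rw [mem_sub, mem_jordan] at h
    have h1 := h ⟨r, by omega⟩
    have h2 : zeroExt y r = y ⟨r, by omega⟩ := zeroExt_val y ⟨r, by omega⟩
    rw [h2]
    simp only [Pi.add_apply, Pi.smul_apply, smul_eq_mul] at h1
    linear_combination h1
  · rw [mem_sub, mem_jordan]
    intro r
    simp [add_comm]

theorem ker_sub_jordan {μ : ℂ} (h : lam ≠ μ) : ker (sub (kernelRep 1 (J lam k)) μ) = ⊥ := by
  refine eq_bot_iff.mpr fun x hx => ?_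
  rw [mem_ker, mem_sub, mem_jordan] at hx
  -- Back substitution from the last coordinate; `d` bounds the distance to the end.
  have key : ∀ d r, k ≤ r + d → zeroExt x r = 0 := by
    intro d
    induction d with
    | zero => exact fun r hr => zeroExt_of_le x hr
    | succ d ih =>
      intro r hr
      by_cases hrk : r < k
      · have h1 := hx ⟨r, hrk⟩
        have h2 : x ⟨r, hrk⟩ = zeroExt x r := (zeroExt_val x ⟨r, hrk⟩).symm
        simp only [zero_add, Pi.smul_apply, smul_eq_mul, h2, ih (r + 1) (by omega), add_zero] at h1
        have h3 : (lam - μ) * zeroExt x r = 0 := by linear_combination h1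
        exact (mul_eq_zero.mp h3).resolve_left (sub_ne_zero.mpr h)
      · exact zeroExt_of_le x (by omega)
  exact eq_zero_of_zeroExt fun j _ => key k j (by omega)

theorem ran_jordan (h : lam ≠ 0) : ran (kernelRep 1 (J lam k)) = ⊤ := by
  have hinj : Function.Injective (J lam k).mulVecLin := by
    rw [← LinearMap.ker_eq_bot, LinearMap.ker_eq_bot']
    intro x hx
    have h1 : x ∈ ker (sub (kernelRep 1 (J lam k)) 0) := by
      rw [sub_zero_eq, mem_ker, mem_kernelRep]
      intro r
      rw [Matrix.mulVec_zero]
      exact congrFun hx r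
    rwa [ker_sub_jordan h] at h1
  refine eq_top_iff.mpr fun y _ => mem_ran.mpr ?_
  obtain ⟨x, hx⟩ := LinearMap.injective_iff_surjective.mp hinj y
  refine ⟨x, mem_kernelRep.mpr fun r => ?_⟩
  rw [Matrix.one_mulVec, ← hx]
  rfl

theorem weyrW_jordan (μ : ℂ) (n : ℕ) :
    weyrW (kernelRep 1 (J lam k)) μ n = if lam = μ ∧ n + 1 ≤ k then 1 else 0 := by
  by_cases h : lam = μ
  · subst h
    rw [weyrW, singChains_eq_bot mul_jordan, sup_bot_eq, sup_bot_eq,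
      quotDim_tail (mem_ker_pow_jordan (n + 1)) (mem_ker_pow_jordan n)]
    simp
  · rw [weyrW_eq_zero_of_ker (ker_sub_jordan h), if_neg fun h' => h h'.1]

/-- For a nonzero eigenvalue the range is everything, for the eigenvalue 0 the root manifold at 0
is. -/
theorem weyrC_jordan (n : ℕ) : weyrC (kernelRep 1 (J lam k)) n = 0 := by
  by_cases h : lam = 0
  · subst h
    refine weyrC_eq_zero_of_rootZero (rootZero_eq_top (k := k) ?_) n
    rw [eq_top_iff, ← sub_zero_eq (kernelRep 1 (J 0 k))]
    exact fun x _ => (mem_ker_pow_jordan k x).mpr fun r hr hk => by omega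
  · exact weyrC_eq_zero_of_ran (ran_jordan h) n

end Jordan

section Infinite

variable {k : ℕ}

theorem mem_infinite {x y : Fin k → ℂ} : (x, y) ∈ kernelRep (N k) 1 ↔
    ∀ r : Fin k, x r = if (r : ℕ) = 0 then 0 else zeroExt y (r - 1) := by
  simp [mem_kernelRep, N_mulVec]

theorem infinite_shift (y : Fin k → ℂ) :
    ((fun r : Fin k => if (r : ℕ) = 0 then 0 else zeroExt y (r - 1)), y) ∈ kernelRep (N k) 1 :=
  mem_infinite.mpr fun _ => rfl

theorem mem_mul_pow_infinite (n : ℕ) (y : Fin k → ℂ) :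
    y ∈ mul (pow (kernelRep (N k) 1) n) ↔ ∀ r < k, r + n < k → zeroExt y r = 0 := by
  refine mem_mul_pow_of_shift (fun x y h r hr => ?_) infinite_shift n y
  have := mem_infinite.mp h ⟨r + 1, hr⟩
  rw [← zeroExt_val x] at this
  simpa using this

/-- Forward substitution: the first coordinate is 0, and each later one is `μ` times its
predecessor. -/
theorem ker_sub_infinite (μ : ℂ) : ker (sub (kernelRep (N k) 1) μ) = ⊥ := by
  refine eq_bot_iff.mpr fun x hx => ?_
  rw [mem_ker, mem_sub, mem_infinite] at hx
  refine eq_zero_of_zeroExt fun j hj => ?_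
  induction j with
  | zero =>
    have := hx ⟨0, hj⟩
    rw [← zeroExt_val x] at this
    simpa using this
  | succ j ih =>
    have := hx ⟨j + 1, hj⟩
    rw [← zeroExt_val x] at this
    simpa [zeroExt_smul, ih (by omega)] using this

theorem rootZero_infinite : rootZero (kernelRep (N k) 1) = ⊥ := by
  apply rootZero_eq_bot
  rw [← sub_zero_eq (kernelRep (N k) 1)]
  exact ker_sub_infinite 0

theorem singChains_infinite : singChains (kernelRep (N k) 1) = ⊥ := by
  rw [singChains, rootZero_infinite, bot_inf_eq]

theorem weyrA_infinite (n : ℕ) :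
    weyrA (kernelRep (N k) 1) n = if n + 1 ≤ k then 1 else 0 := by
  rw [weyrA, singChains_infinite, sup_bot_eq, sup_bot_eq]
  split_ifs with h
  -- `r₀` is the only index with `r + n < k` but not `r + (n + 1) < k`.
  · exact quotDim_eq_one_of_coord (mem_mul_pow_infinite (n + 1)) (mem_mul_pow_infinite n)
      (r₀ := k - 1 - n) (by omega) (by omega) fun r hr => by omega
  · exact quotDim_eq_zero_of_coord (mem_mul_pow_infinite (n + 1)) (mem_mul_pow_infinite n)
      fun r hr => by omega

end Infinite

section Column

variable {k : ℕ}

theorem mem_column {x y : Fin k → ℂ} : (x, y) ∈ kernelRep (K k) (L k) ↔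
    ∀ r, r + 1 < k → zeroExt x (r + 1) = zeroExt y r := by
  simp only [mem_kernelRep, K_mulVec, L_mulVec]
  exact ⟨fun h r hr => h ⟨r, by omega⟩, fun h r => h r (by omega)⟩

theorem column_shift (y : Fin k → ℂ) :
    ((fun r : Fin k => if (r : ℕ) = 0 then 0 else zeroExt y (r - 1)), y)
      ∈ kernelRep (K k) (L k) := by
  refine mem_column.mpr fun r hr => ?_
  rw [zeroExt_mk (fun r => if r = 0 then 0 else zeroExt y (r - 1)) hr]
  simp

theorem mem_ker_pow_column (n : ℕ) (x : Fin k → ℂ) :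
    x ∈ ker (pow (kernelRep (K k) (L k)) n) ↔ ∀ r < k, n ≤ r → zeroExt x r = 0 := by
  refine mem_ker_pow_of_shift (fun x y h => mem_column.mp h) (fun x => ?_) n x
  refine mem_column.mpr fun r hr => ?_
  rw [zeroExt_mk (fun r => zeroExt x (r + 1)) (by omega)]

theorem rootZero_column : rootZero (kernelRep (K k) (L k)) = ⊤ :=
  rootZero_eq_top (k := k) <| eq_top_iff.mpr fun x _ =>
    (mem_ker_pow_column k x).mpr fun r hr hk => by omega

/-- Every vector is reached from 0 and leads to 0 in `k` steps. -/
theorem singChains_column : singChains (kernelRep (K k) (L k)) = ⊤ := by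
  rw [singChains, rootZero_column, top_inf_eq]
  exact rootInfty_eq_top (k := k) <| eq_top_iff.mpr fun y _ =>
    (mem_mul_pow_of_shift (fun x y h => mem_column.mp h) column_shift k y).mpr
      fun r hr hk => by omega

theorem weyrB_column (n : ℕ) :
    weyrB (kernelRep (K k) (L k)) n = if n + 1 ≤ k then 1 else 0 := by
  rw [weyrB, singChains_column, inf_top_eq, inf_top_eq,
    quotDim_tail (mem_ker_pow_column (n + 1)) (mem_ker_pow_column n)]

end Column

section Row

variable {k : ℕ}

theorem mem_row {x y : Fin (k - 1) → ℂ} :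
    (x, y) ∈ kernelRep (K k).transpose (L k).transpose ↔
      ∀ r < k, (if r = 0 then 0 else zeroExt x (r - 1)) = zeroExt y r := by
  simp only [mem_kernelRep, K_transpose_mulVec, L_transpose_mulVec]
  exact ⟨fun h r hr => h ⟨r, hr⟩, fun h r => h r r.2⟩

theorem mul_row : mul (kernelRep (K k).transpose (L k).transpose) = ⊥ := by
  refine eq_bot_iff.mpr fun y hy => ?_
  rw [mem_mul, mem_row] at hy
  exact eq_zero_of_zeroExt fun j hj => by simpa using (hy j (by omega)).symm

theorem ker_sub_row (μ : ℂ) : ker (sub (kernelRep (K k).transpose (L k).transpose) μ) = ⊥ := by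
  refine eq_bot_iff.mpr fun x hx => ?_
  rw [mem_ker, mem_sub, mem_row] at hx
  have key : ∀ d r, k - 1 ≤ r + d → zeroExt x r = 0 := by
    intro d
    induction d with
    | zero => exact fun r hr => zeroExt_of_le x hr
    | succ d ih =>
      intro r hr
      by_cases hrk : r < k - 1
      · have h1 := hx (r + 1) (by omega)
        simpa [zeroExt_smul, ih (r + 1) (by omega)] using h1
      · exact zeroExt_of_le x (by omega)
  exact eq_zero_of_zeroExt fun j _ => key (k - 1) j (by omega)

theorem rootZero_row : rootZero (kernelRep (K k).transpose (L k).transpose) = ⊥ := by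
  apply rootZero_eq_bot
  rw [← sub_zero_eq (kernelRep _ _)]
  exact ker_sub_row 0

/-- The relation is the forward shift restricted to vectors with last coordinate 0. It inserts a
leading zero at each step, and a vector with `n` leading zeros can be shifted back `n` times. -/
theorem mem_ran_pow_row (n : ℕ) (y : Fin (k - 1) → ℂ) :
    y ∈ ran (pow (kernelRep (K k).transpose (L k).transpose) n) ↔
      ∀ r < k - 1, r < n → zeroExt y r = 0 := by
  induction n generalizing y with
  | zero => simp [ran_pow_zero]
  | succ n ih =>
    rw [mem_ran_pow_succ]
    constructor
    · rintro ⟨x, hx, hxy⟩ r hr hn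
      rw [← mem_row.mp hxy r (by omega)]
      split_ifs with h0
      · rfl
      · exact (ih x).mp hx _ (by omega) (by omega)
    · intro h
      refine ⟨fun r => zeroExt y (r + 1), (ih _).mpr fun r hr hn => ?_, mem_row.mpr fun r hr => ?_⟩
      · rw [zeroExt_mk (fun r => zeroExt y (r + 1)) hr]
        by_cases hrk : r + 1 < k - 1
        · exact h _ hrk (by omega)
        · exact zeroExt_of_le y (by omega)
      · split_ifs with h0
        · subst h0
          by_cases hk : 0 < k - 1
          · exact (h 0 hk (by omega)).symm
          · exact (zeroExt_of_le y (by omega)).symm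
        · rw [zeroExt_mk (fun r => zeroExt y (r + 1)) (by omega), Nat.sub_add_cancel (by omega)]

theorem weyrC_row (n : ℕ) :
    weyrC (kernelRep (K k).transpose (L k).transpose) n = if n + 3 ≤ k then 1 else 0 := by
  cases n with
  | zero =>
    have hran : ∀ y, y ∈ ran (kernelRep (K k).transpose (L k).transpose) ↔
        ∀ r < k - 1, r < 1 → zeroExt y r = 0 := fun y => by
      rw [← ran_pow_one]
      exact mem_ran_pow_row 1 y
    simp only [weyrC, rootZero_row, sup_bot_eq]
    split_ifs with h
    · refine quotDim_eq_one (LinearMap.proj ⟨0, by omega⟩) (fun x _ => ?_)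
        ⟨Pi.single ⟨0, by omega⟩ 1, ?_, ?_⟩
      · rw [hran]
        constructor
        · intro hx r hr hr1
          obtain rfl : r = 0 := by omega
          exact (zeroExt_val x ⟨0, hr⟩).trans hx
        · intro hx
          rw [← hx 0 (by omega) (by omega)]
          exact (zeroExt_val x ⟨0, by omega⟩).symm
      -- The relation maps the first unit vector to the second, which requires `k - 1 ≥ 2`.
      · refine Submodule.mem_sup_right (mem_dom.mpr ⟨Pi.single ⟨1, by omega⟩ 1, ?_⟩)
        refine mem_row.mpr fun r hr => ?_
        rcases r with _ | _ | r
        · simp [zeroExt]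
        · have : 0 < k - 1 := by omega
          have : 1 < k - 1 := by omega
          simp [zeroExt, *]
        · simp [zeroExt]
      · simp
    -- For `k = 2` the range is zero in a one-dimensional space. C_1 skips this block only because
    -- its numerator uses dom S instead of the whole space.
    · have hdom : dom (kernelRep (K k).transpose (L k).transpose) = ⊥ := by
        refine eq_bot_iff.mpr fun x hx => ?_
        obtain ⟨y, hxy⟩ := mem_dom.mp hx
        refine eq_zero_of_zeroExt fun j hj => ?_
        have := mem_row.mp hxy (j + 1) (by omega)
        rw [zeroExt_of_le y (by omega)] at this
        simpa using this
      rw [hdom, sup_bot_eq, quotDim_self]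
  | succ n =>
    simp only [weyrC, rootZero_row, sup_bot_eq]
    split_ifs with h
    · exact quotDim_eq_one_of_coord (mem_ran_pow_row (n + 2)) (mem_ran_pow_row (n + 3))
        (r₀ := n + 2) (by omega) (by omega) fun r hr => by omega
    · exact quotDim_eq_zero_of_coord (mem_ran_pow_row (n + 2)) (mem_ran_pow_row (n + 3))
        fun r hr => by omega

end Row

/-! ### From the blocks to the pencil -/

open LinRel

/-- The kernel representation of a block. -/
def Block.rel (b : Block) : LinRel (Fin b.cols → ℂ) := kernelRep b.matE b.matF

/-- The change of basis in the target is injective, so it does not affect the solutions of `F x = E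
y`. -/
theorem FormedBy.isDirectSum {ι : Type*} {n m : ℕ} {E F : Matrix (Fin n) (Fin m) ℂ}
    {blk : ι → Block} (h : FormedBy blk E.mulVecLin F.mulVecLin) :
    ∃ e : (Fin m → ℂ) ≃ₗ[ℂ] ((i : ι) → Fin (blk i).cols → ℂ),
      IsDirectSum e (kernelRep E F) fun i => (blk i).rel := by
  obtain ⟨eX, eY, hE, hF⟩ := h
  refine ⟨eX, fun x y => ?_⟩
  have h1 : (x, y) ∈ kernelRep E F ↔ F.mulVecLin x = E.mulVecLin y := Iff.rfl
  rw [h1, ← eY.injective.eq_iff, funext_iff]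
  refine forall_congr' fun i => ?_
  rw [hE, hF]
  rfl

theorem FormedBy.card_cols {ι : Type*} [Fintype ι] {X Y : Type*} [AddCommGroup X] [Module ℂ X]
    [AddCommGroup Y] [Module ℂ Y] {E F : X →ₗ[ℂ] Y} {blk : ι → Block} (h : FormedBy blk E F) :
    Module.finrank ℂ X = ∑ i, (blk i).cols := by
  obtain ⟨eX, -⟩ := h
  rw [eX.finrank_eq, Module.finrank_pi_fintype]
  simp

theorem FormedBy.card_rows {ι : Type*} [Fintype ι] {X Y : Type*} [AddCommGroup X] [Module ℂ X]
    [AddCommGroup Y] [Module ℂ Y] {E F : X →ₗ[ℂ] Y} {blk : ι → Block} (h : FormedBy blk E F) :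
    Module.finrank ℂ Y = ∑ i, (blk i).rows := by
  obtain ⟨-, eY, -⟩ := h
  rw [eY.finrank_eq, Module.finrank_pi_fintype]
  simp

theorem conj_eq_sum {l : ℕ} (t : Fin l → ℕ) (k : ℕ) :
    conj t k = ∑ i, if k + 1 ≤ t i then 1 else 0 := by
  rw [conj, Finset.card_filter]

namespace Data

variable {D : Data} {n m : ℕ} {E F : Matrix (Fin n) (Fin m) ℂ}

theorem IsFormOf.isDirectSum (h : D.IsFormOf E F) :
    ∃ e : (Fin m → ℂ) ≃ₗ[ℂ] ((i : D.Idx) → Fin (D.block i).cols → ℂ),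
      IsDirectSum e (kernelRep E F) fun i => (D.block i).rel :=
  (D.formedBy_of_isFormOf h).isDirectSum

theorem weyr_w_eq_sum (D : Data) (μ : ℂ) (k : ℕ) :
    D.weyr.w μ k = ∑ i, if D.eig i = μ ∧ k + 1 ≤ D.size i then 1 else 0 := by
  classical
  simp only [weyr]
  rw [Nat.card_eq_fintype_card, Fintype.card_subtype, Finset.card_filter]

theorem IsFormOf.weyrW_eq (h : D.IsFormOf E F) : weyrW (kernelRep E F) = D.weyr.w := by
  obtain ⟨e, he⟩ := h.isDirectSum
  funext μ k
  rw [he.weyrW, Fintype.sum_sum_type, Fintype.sum_sum_type, Fintype.sum_sum_type, weyr_w_eq_sum]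
  have h1 : ∀ i : Fin D.nJ, LinRel.weyrW (D.block (.inl (.inl i))).rel μ k = _ :=
    fun i => weyrW_jordan (lam := D.eig i) (k := D.size i) μ k
  have h2 : ∀ i : Fin D.nα, LinRel.weyrW (D.block (.inl (.inr i))).rel μ k = 0 :=
    fun i => weyrW_eq_zero_of_ker (ker_sub_infinite (k := D.α i) μ) k
  have h3 : ∀ i : Fin D.nβ, LinRel.weyrW (D.block (.inr (.inl i))).rel μ k = 0 :=
    fun i => weyrW_eq_zero_of_singChains (singChains_column (k := D.β i)) μ k
  have h4 : ∀ i : Fin D.nγ, LinRel.weyrW (D.block (.inr (.inr i))).rel μ k = 0 :=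
    fun i => weyrW_eq_zero_of_ker (ker_sub_row (k := D.γ i) μ) k
  simp only [h1, h2, h3, h4, Finset.sum_const_zero, add_zero]

theorem IsFormOf.weyrA_eq (h : D.IsFormOf E F) : weyrA (kernelRep E F) = conj D.α := by
  obtain ⟨e, he⟩ := h.isDirectSum
  funext k
  rw [he.weyrA, Fintype.sum_sum_type, Fintype.sum_sum_type, Fintype.sum_sum_type, conj_eq_sum]
  have h1 : ∀ i : Fin D.nJ, LinRel.weyrA (D.block (.inl (.inl i))).rel k = 0 :=
    fun i => weyrA_eq_zero_of_mul (mul_jordan (lam := D.eig i) (k := D.size i)) k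
  have h2 : ∀ i : Fin D.nα, LinRel.weyrA (D.block (.inl (.inr i))).rel k = _ :=
    fun i => weyrA_infinite (k := D.α i) k
  have h3 : ∀ i : Fin D.nβ, LinRel.weyrA (D.block (.inr (.inl i))).rel k = 0 :=
    fun i => weyrA_eq_zero_of_singChains (singChains_column (k := D.β i)) k
  have h4 : ∀ i : Fin D.nγ, LinRel.weyrA (D.block (.inr (.inr i))).rel k = 0 :=
    fun i => weyrA_eq_zero_of_mul (mul_row (k := D.γ i)) k
  simp only [h1, h2, h3, h4, Finset.sum_const_zero, add_zero, zero_add]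

theorem IsFormOf.weyrB_eq (h : D.IsFormOf E F) : weyrB (kernelRep E F) = conj D.β := by
  obtain ⟨e, he⟩ := h.isDirectSum
  funext k
  rw [he.weyrB, Fintype.sum_sum_type, Fintype.sum_sum_type, Fintype.sum_sum_type, conj_eq_sum]
  have h1 : ∀ i : Fin D.nJ, LinRel.weyrB (D.block (.inl (.inl i))).rel k = 0 :=
    fun i => weyrB_eq_zero_of_singChains
      (singChains_eq_bot (mul_jordan (lam := D.eig i) (k := D.size i))) k
  have h2 : ∀ i : Fin D.nα, LinRel.weyrB (D.block (.inl (.inr i))).rel k = 0 :=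
    fun i => weyrB_eq_zero_of_singChains (singChains_infinite (k := D.α i)) k
  have h3 : ∀ i : Fin D.nβ, LinRel.weyrB (D.block (.inr (.inl i))).rel k = _ :=
    fun i => weyrB_column (k := D.β i) k
  have h4 : ∀ i : Fin D.nγ, LinRel.weyrB (D.block (.inr (.inr i))).rel k = 0 :=
    fun i => weyrB_eq_zero_of_singChains (singChains_eq_bot (mul_row (k := D.γ i))) k
  simp only [h1, h2, h3, h4, Finset.sum_const_zero, add_zero, zero_add]

theorem IsFormOf.weyrC_eq (h : D.IsFormOf E F) (k : ℕ) :
    weyrC (kernelRep E F) k = conj D.γ (k + 2) := by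
  obtain ⟨e, he⟩ := h.isDirectSum
  rw [he.weyrC, Fintype.sum_sum_type, Fintype.sum_sum_type, Fintype.sum_sum_type, conj_eq_sum]
  have h1 : ∀ i : Fin D.nJ, LinRel.weyrC (D.block (.inl (.inl i))).rel k = 0 :=
    fun i => weyrC_jordan (lam := D.eig i) (k := D.size i) k
  have h2 : ∀ i : Fin D.nα, LinRel.weyrC (D.block (.inl (.inr i))).rel k = 0 :=
    fun i => weyrC_eq_zero_of_ran (ran_eq_top_of_shift (infinite_shift (k := D.α i))) k
  have h3 : ∀ i : Fin D.nβ, LinRel.weyrC (D.block (.inr (.inl i))).rel k = 0 :=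
    fun i => weyrC_eq_zero_of_rootZero (rootZero_column (k := D.β i)) k
  have h4 : ∀ i : Fin D.nγ, LinRel.weyrC (D.block (.inr (.inr i))).rel k = _ :=
    fun i => weyrC_row (k := D.γ i) k
  simp only [h1, h2, h3, h4, Finset.sum_const_zero, zero_add]

theorem IsFormOf.cols_eq (h : D.IsFormOf E F) :
    m = ∑ i, D.size i + ∑ i, D.α i + (∑ i, D.β i + ∑ i, (D.γ i - 1)) := by
  have := (D.formedBy_of_isFormOf h).card_cols
  rw [Module.finrank_fintype_fun_eq_card, Fintype.card_fin] at this
  rw [this, Fintype.sum_sum_type, Fintype.sum_sum_type, Fintype.sum_sum_type]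
  rfl

theorem IsFormOf.rows_eq (h : D.IsFormOf E F) :
    n = ∑ i, D.size i + ∑ i, D.α i + (∑ i, (D.β i - 1) + ∑ i, D.γ i) := by
  have := (D.formedBy_of_isFormOf h).card_rows
  rw [Module.finrank_fintype_fun_eq_card, Fintype.card_fin] at this
  rw [this, Fintype.sum_sum_type, Fintype.sum_sum_type, Fintype.sum_sum_type]
  rfl

end Data

/-! ## Absolute values -/

theorem finsum_ite_succ_le (a : ℕ) : ∑ᶠ k, (if k + 1 ≤ a then 1 else 0) = a := by
  rw [finsum_eq_sum_of_support_subset (s := Finset.range a)]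
  · rw [Finset.sum_congr rfl fun k hk => if_pos (Nat.succ_le_of_lt (Finset.mem_range.mp hk))]
    simp
  · intro k hk
    by_contra h
    simp only [Finset.coe_range, Set.mem_Iio] at h
    exact hk (if_neg (by omega))

theorem finite_support_ite_succ_le (a : ℕ) :
    (Function.support fun k => if k + 1 ≤ a then 1 else 0).Finite := by
  refine (Set.finite_Iio a).subset fun k hk => ?_
  by_contra h
  simp only [Set.mem_Iio] at h
  exact hk (if_neg (by omega))

/-- Exchanging the sums, each entry `t i` is counted once for every `k < t i`. -/
theorem seqAbs_sum {l : ℕ} (t : Fin l → ℕ) :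
    seqAbs (fun k => ∑ i, if k + 1 ≤ t i then 1 else 0) = ∑ i, t i := by
  rw [seqAbs, finsum_sum_comm _ _ fun i _ => finite_support_ite_succ_le (t i)]
  exact Finset.sum_congr rfl fun i _ => finsum_ite_succ_le (t i)

theorem seqAbs_conj {l : ℕ} (t : Fin l → ℕ) : seqAbs (conj t) = ∑ i, t i := by
  rw [← seqAbs_sum]
  exact congrArg _ (funext fun k => conj_eq_sum t k)

theorem seqAbs_conj_add_two {l : ℕ} (t : Fin l → ℕ) :
    seqAbs (fun k => conj t (k + 2)) = ∑ i, (t i - 2) := by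
  rw [← seqAbs_sum]
  refine congrArg _ (funext fun k => ?_)
  rw [conj_eq_sum]
  refine Finset.sum_congr rfl fun i _ => ?_
  congr 1
  exact propext (by omega)

theorem famAbs_weyr_w (D : Data) : famAbs D.weyr.w = ∑ i, D.size i := by
  classical
  have h1 : ∀ μ, seqAbs (D.weyr.w μ) = ∑ i, if D.eig i = μ then D.size i else 0 := by
    intro μ
    -- Blocks with another eigenvalue are given size 0, which brings the sequence into the form of
    -- `seqAbs_sum`.
    have : D.weyr.w μ
        = fun k => ∑ i, if k + 1 ≤ (if D.eig i = μ then D.size i else 0) then 1 else 0 := by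
      funext k
      rw [Data.weyr_w_eq_sum]
      refine Finset.sum_congr rfl fun i _ => ?_
      by_cases h : D.eig i = μ <;> simp [h]
    rw [this, seqAbs_sum]
  rw [famAbs, finsum_congr h1, finsum_sum_comm]
  · refine Finset.sum_congr rfl fun i _ => ?_
    rw [finsum_eq_single _ (D.eig i) fun μ hμ => if_neg hμ.symm, if_pos rfl]
  · intro i _
    refine (Set.finite_singleton (D.eig i)).subset fun μ hμ => ?_
    by_contra h
    exact hμ (if_neg fun h' => h h'.symm)

theorem sum_sub_one_add_conj_zero {l : ℕ} (t : Fin l → ℕ) :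
    ∑ i, (t i - 1) + conj t 0 = ∑ i, t i := by
  rw [conj_eq_sum, ← Finset.sum_add_distrib]
  refine Finset.sum_congr rfl fun i _ => ?_
  split_ifs <;> omega

/-- An entry `t i ≥ 2` loses one more unit on passing from `t i - 1` to `t i - 2`; for smaller
entries both truncated differences are 0. -/
theorem sum_sub_two_add_conj_one {l : ℕ} (t : Fin l → ℕ) :
    ∑ i, (t i - 2) + conj t 1 = ∑ i, (t i - 1) := by
  rw [conj_eq_sum, ← Finset.sum_add_distrib]
  refine Finset.sum_congr rfl fun i _ => ?_
  split_ifs <;> omega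

/-- The formulas expressing the Weyr characteristic of a pencil by that of its kernel
representation. -/
theorem Data.IsFormOf.weyr_eq {D : Data} {n m : ℕ} {E F : Matrix (Fin n) (Fin m) ℂ}
    (h : D.IsFormOf E F) :
    D.weyr.w = (kernelRep E F).weyr.w ∧ D.weyr.a = (kernelRep E F).weyr.a ∧
      D.weyr.b = (kernelRep E F).weyr.b ∧
      (D.weyr.c 0 : ℤ) = (n : ℤ) - m + (kernelRep E F).weyr.b 0 ∧
      (D.weyr.c 1 : ℤ) = (m : ℤ) - famAbs (kernelRep E F).weyr.w - seqAbs (kernelRep E F).weyr.a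
        - seqAbs (kernelRep E F).weyr.b - seqAbs (kernelRep E F).weyr.c ∧
      ∀ k : ℕ, D.weyr.c (k + 2) = (kernelRep E F).weyr.c k := by
  have hw : (kernelRep E F).weyr.w = D.weyr.w := h.weyrW_eq
  have ha : (kernelRep E F).weyr.a = conj D.α := h.weyrA_eq
  have hb : (kernelRep E F).weyr.b = conj D.β := h.weyrB_eq
  have hc : (kernelRep E F).weyr.c = fun k => conj D.γ (k + 2) := funext h.weyrC_eq
  have hm := h.cols_eq
  have hn := h.rows_eq
  have hβ := sum_sub_one_add_conj_zero D.β
  have hγ := sum_sub_one_add_conj_zero D.γ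
  have hγ' := sum_sub_two_add_conj_one D.γ
  refine ⟨hw.symm, ha.symm, hb.symm, ?_, ?_, fun k => (congrFun hc k).symm⟩
  · rw [hb]
    -- A column block has one column more than rows, a row block one row more than columns: n - m =
    -- c_1 - b_1.
    change (conj D.γ 0 : ℤ) = _
    omega
  · rw [hw, ha, hb, hc, famAbs_weyr_w, seqAbs_conj, seqAbs_conj, seqAbs_conj_add_two]
    -- In the column count m, the row blocks contribute ∑ (γ_i - 1) = c_2 + |C|.
    change (conj D.γ 1 : ℤ) = _
    omega

end Kronecker

/-! ### The main theorem -/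

theorem mainTheorem5 (n m : ℕ) (S : LinRel (Fin m → ℂ)) (E F : Matrix (Fin n) (Fin m) ℂ)
    (hS : kernelRep E F = S) :
    (∃! ω : WeyrChar, IsPencilWeyr E F ω) ∧
    ∀ ω : WeyrChar, IsPencilWeyr E F ω →
      ω.w = S.weyr.w ∧ ω.a = S.weyr.a ∧ ω.b = S.weyr.b ∧
      (ω.c 0 : ℤ) = (n : ℤ) - m + S.weyr.b 0 ∧
      (ω.c 1 : ℤ) = (m : ℤ) - famAbs S.weyr.w - seqAbs S.weyr.a - seqAbs S.weyr.b
        - seqAbs S.weyr.c ∧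
      ∀ k : ℕ, ω.c (k + 2) = S.weyr.c k := by
  subst hS
  refine ⟨?_, ?_⟩
  · obtain ⟨D, hD⟩ := Kronecker.exists_isFormOf E F
    refine ⟨D.weyr, ⟨D, hD, rfl⟩, ?_⟩
    rintro _ ⟨D', hD', rfl⟩
    obtain ⟨hw, ha, hb, h0, h1, h2⟩ := hD.weyr_eq
    obtain ⟨hw', ha', hb', h0', h1', h2'⟩ := hD'.weyr_eq
    -- Two canonical forms agree because both are expressed by the same quantities of the relation
    -- and by n and m.
    refine WeyrChar.ext (hw'.trans hw.symm) (ha'.trans ha.symm) (hb'.trans hb.symm) ?_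
    funext k
    match k with
    | 0 => exact_mod_cast h0'.trans h0.symm
    | 1 => exact_mod_cast h1'.trans h1.symm
    | k + 2 => exact (h2' k).trans (h2 k).symm
  · rintro _ ⟨D, hD, rfl⟩
    exact hD.weyr_eq
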